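/- Let $S$ be $\mathbb{R}$, $\mathbb{R}\setminus\{0\}$, a strip $[0,T]\times\mathbb{R}$ with $T>0$, or a relatively open subset of one of these, and let $\mathcal{C}^\infty(S)$ be the real-valued smooth functions on $S$ (smooth up to the part of the boundary contained in $S$: all derivatives extend continuously to it). The special Colombeau algebra is $\mathcal{G}(S)=\mathcal{E}_M(S)/\mathcal{N}(S)$, where $\mathcal{E}_M(S)$ consists of the nets $(u^\varepsilon)_{\varepsilon\in(0,1]}$ in $\mathcal{C}^\infty(S)$ such that for every compact $K\subset S$ and every multi-index $\alpha$ there is $b\in\mathbb{R}$ with $\sup_K|\partial^\alpha u^\varepsilon|=O(\varepsilon^b)$ as $\varepsilon\downarrow0$, and $\mathcal{N}(S)$ of the nets for which $\sup_K|\partial^\alpha u^\varepsilon|=O(\varepsilon^a)$ for all such $K$, $\alpha$ and all $a\ge0$. Derivatives, restrictions to relatively open subsets, restriction to $t=0$, and $f(U)$ for $f\in\mathcal{O}_M(\mathbb{R})$ (smooth functions on $\mathbb{R}$ each of whose derivatives grows at most polynomially) are defined on representatives. An element $U\in\mathcal{G}(S)$ is of bounded type on $L\subset S$ if it has a representative with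 $\sup_{L}|u^\varepsilon|=O(1)$ as $\varepsilon\downarrow0$; $\mathcal{G}^0(S)$ is the set of $U\in\mathcal{G}(S)$ all of whose derivatives of any order are of bounded type on every compact subset of $S$. The support of $U$ is the complement in $S$ of the largest relatively open $\omega\subset S$ with $U|_\omega=0$, and $\operatorname{sing\,supp}_{\mathcal{G}^0}U$ is the complement in $S$ of the largest relatively open $\omega\subset S$ with $U|_\omega\in\mathcal{G}^0(\omega)$. The ring of generalized numbers $\widetilde{\mathbb{R}}$ consists of the nets of real numbers that are $O(\varepsilon^b)$ for some $b\in\mathbb{R}$, modulo the nets that are $O(\varepsilon^a)$ for all $a\ge0$; it acts on $\mathcal{G}(S)$ by multiplication with constant functions. **Theorem.** Let $E\in\widetilde{\mathbb{R}}$ be the generalized number with representative $(\varepsilon)_{\varepsilon\in(0,1]}$. Let $f\in\mathcal{O}_M(\mathbb{R})$ with $f(0)=0$. Let $U_0,U_1\in\mathcal{G}(\mathbb{R})$ have compact support and satisfy $U_0|_{\mathbb{R}\setminus\{0\}},\,U_1|_{\mathbb{R}\setminus\{0\}}\in\mathcal{G}^0(\mathbb{R}\setminus\{0\})$, and let $U_0'$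 and $U_1$ be of bounded type on $\mathbb{R}$. Then for every $T>0$ there exists $U\in\mathcal{G}([0,T]\times\mathbb{R})$ such that $$\partial_t^2U-\partial_x^2U=E\,f(U)\ \text{ in }\mathcal{G}([0,T]\times\mathbb{R}),\qquad U|_{t=0}=U_0,\quad \partial_tU|_{t=0}=U_1\ \text{ in }\mathcal{G}(\mathbb{R}),$$ and $$\operatorname{sing\,supp}_{\mathcal{G}^0}U\subset\{(t,x):|x|=t,\ 0\le t\le T\}.$$ -/

import Mathlib

open Set Filter Topology
open scoped ContDiff

namespace Colombeau

/-! ### Landau conditions for nets indexed by the interval (0,1] -/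

/-- The parameter interval `(0,1]`. -/
abbrev Eps : Type := Set.Ioc (0 : ℝ) 1

/-- The filter `ε ↓ 0` on `(0,1]`. -/
def toZero : Filter Eps := Filter.comap (fun ε : Eps => (ε : ℝ)) (𝓝 0)

/-- `sup_{x ∈ K} |φ ε x| = O(ε ^ b)` as `ε ↓ 0`. -/
def UnifBigO {X : Type*} (K : Set X) (φ : Eps → X → ℝ) (b : ℝ) : Prop :=
  ∃ C : ℝ, ∀ᶠ ε in toZero, ∀ x ∈ K, |φ ε x| ≤ C * (ε : ℝ) ^ b

/-- `sup_{x ∈ K} |φ ε x| = O(ε ^ b)` for some real `b`. -/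
def ModOn {X : Type*} (K : Set X) (φ : Eps → X → ℝ) : Prop :=
  ∃ b : ℝ, UnifBigO K φ b

/-- `sup_{x ∈ K} |φ ε x| = O(ε ^ a)` for all `a ≥ 0`. -/
def NegOn {X : Type*} (K : Set X) (φ : Eps → X → ℝ) : Prop :=
  ∀ a : ℝ, 0 ≤ a → UnifBigO K φ a

section Landau

variable {X : Type*} {K : Set X} {φ ψ : Eps → X → ℝ} {b c : ℝ}

theorem UnifBigO.mono_exp (h : UnifBigO K φ b) (hcb : c ≤ b) : UnifBigO K φ c := by
  obtain ⟨C, hC⟩ := h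
  refine ⟨|C|, hC.mono fun ε hε x hx => (hε x hx).trans ?_⟩
  have h1 : (ε : ℝ) ^ b ≤ (ε : ℝ) ^ c :=
    Real.rpow_le_rpow_of_exponent_ge ε.2.1 ε.2.2 hcb
  have h0 : 0 ≤ (ε : ℝ) ^ b := Real.rpow_nonneg ε.2.1.le _
  calc C * (ε : ℝ) ^ b ≤ |C| * (ε : ℝ) ^ b := by gcongr; exact le_abs_self C
    _ ≤ |C| * (ε : ℝ) ^ c := by gcongr

theorem UnifBigO.of_le (h : UnifBigO K ψ b) (hle : ∀ ε, ∀ x ∈ K, |φ ε x| ≤ |ψ ε x|) :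
    UnifBigO K φ b := by
  obtain ⟨C, hC⟩ := h
  exact ⟨C, hC.mono fun ε hε x hx => (hle ε x hx).trans (hε x hx)⟩

theorem UnifBigO.add (h : UnifBigO K φ b) (h' : UnifBigO K ψ b) :
    UnifBigO K (fun ε x => φ ε x + ψ ε x) b := by
  obtain ⟨C, hC⟩ := h
  obtain ⟨C', hC'⟩ := h'
  refine ⟨C + C', (hC.and hC').mono fun ε hε x hx => ?_⟩
  calc |φ ε x + ψ ε x| ≤ |φ ε x| + |ψ ε x| := abs_add_le _ _
    _ ≤ C * (ε : ℝ) ^ b + C' * (ε : ℝ) ^ b := add_le_add (hε.1 x hx) (hε.2 x hx)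
    _ = _ := by ring

theorem UnifBigO.mul (h : UnifBigO K φ b) (h' : UnifBigO K ψ c) :
    UnifBigO K (fun ε x => φ ε x * ψ ε x) (b + c) := by
  obtain ⟨C, hC⟩ := h
  obtain ⟨C', hC'⟩ := h'
  refine ⟨C * C', (hC.and hC').mono fun ε hε x hx => ?_⟩
  have h1 := hε.1 x hx
  have h2 := hε.2 x hx
  calc |φ ε x * ψ ε x| = |φ ε x| * |ψ ε x| := abs_mul _ _
    _ ≤ (C * (ε : ℝ) ^ b) * (C' * (ε : ℝ) ^ c) :=
        mul_le_mul h1 h2 (abs_nonneg _) ((abs_nonneg _).trans h1)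
    _ = C * C' * (ε : ℝ) ^ (b + c) := by rw [Real.rpow_add ε.2.1]; ring

theorem unifBigO_const (r : ℝ) : UnifBigO K (fun _ _ => r) 0 :=
  ⟨|r|, Eventually.of_forall fun ε x _ => by simp⟩

theorem NegOn.modOn (h : NegOn K φ) : ModOn K φ := ⟨0, h 0 le_rfl⟩

theorem modOn_const (r : ℝ) : ModOn K (fun _ _ => r) := ⟨0, unifBigO_const r⟩

theorem negOn_zero : NegOn K (fun _ _ => (0 : ℝ)) := fun a _ =>
  ⟨0, Eventually.of_forall fun ε x _ => by simp⟩

theorem ModOn.of_le (h : ModOn K ψ) (hle : ∀ ε, ∀ x ∈ K, |φ ε x| ≤ |ψ ε x|) : ModOn K φ :=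
  h.imp fun _ hb => hb.of_le hle

theorem NegOn.of_le (h : NegOn K ψ) (hle : ∀ ε, ∀ x ∈ K, |φ ε x| ≤ |ψ ε x|) : NegOn K φ :=
  fun a ha => (h a ha).of_le hle

theorem ModOn.add (h : ModOn K φ) (h' : ModOn K ψ) : ModOn K (fun ε x => φ ε x + ψ ε x) := by
  obtain ⟨b, hb⟩ := h
  obtain ⟨c, hc⟩ := h'
  exact ⟨min b c, (hb.mono_exp (min_le_left _ _)).add (hc.mono_exp (min_le_right _ _))⟩

theorem NegOn.add (h : NegOn K φ) (h' : NegOn K ψ) : NegOn K (fun ε x => φ ε x + ψ ε x) :=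
  fun a ha => (h a ha).add (h' a ha)

theorem ModOn.mul (h : ModOn K φ) (h' : ModOn K ψ) : ModOn K (fun ε x => φ ε x * ψ ε x) := by
  obtain ⟨b, hb⟩ := h
  obtain ⟨c, hc⟩ := h'
  exact ⟨b + c, hb.mul hc⟩

theorem ModOn.mul_negOn (h : ModOn K φ) (h' : NegOn K ψ) :
    NegOn K (fun ε x => φ ε x * ψ ε x) := by
  obtain ⟨b, hb⟩ := h
  intro a ha
  refine (hb.mul (h' (|b| + a) (by positivity))).mono_exp ?_
  have := neg_abs_le b
  linarith

theorem NegOn.mul_modOn (h : NegOn K φ) (h' : ModOn K ψ) :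
    NegOn K (fun ε x => φ ε x * ψ ε x) :=
  (h'.mul_negOn h).of_le fun ε x _ => by rw [mul_comm]

theorem ModOn.pow (h : ModOn K φ) (n : ℕ) : ModOn K (fun ε x => φ ε x ^ n) := by
  induction n with
  | zero => simpa using modOn_const (K := K) 1
  | succ n ih => simpa only [pow_succ] using ih.mul h

theorem ModOn.sum {ι : Type*} (s : Finset ι) {Φ : ι → Eps → X → ℝ}
    (h : ∀ i ∈ s, ModOn K (Φ i)) : ModOn K (fun ε x => ∑ i ∈ s, Φ i ε x) := by
  classical
  induction s using Finset.induction_on with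
  | empty => simpa using modOn_const (K := K) 0
  | insert i s hi ih =>
    simp only [Finset.sum_insert hi]
    exact (h i (Finset.mem_insert_self i s)).add
      (ih fun j hj => h j (Finset.mem_insert_of_mem hj))

theorem NegOn.sum {ι : Type*} (s : Finset ι) {Φ : ι → Eps → X → ℝ}
    (h : ∀ i ∈ s, NegOn K (Φ i)) : NegOn K (fun ε x => ∑ i ∈ s, Φ i ε x) := by
  classical
  induction s using Finset.induction_on with
  | empty => simpa using negOn_zero (K := K)
  | insert i s hi ih =>
    simp only [Finset.sum_insert hi]
    exact (h i (Finset.mem_insert_self i s)).add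
      (ih fun j hj => h j (Finset.mem_insert_of_mem hj))

theorem ModOn.image {Y : Type*} {g : Y → X} {L : Set Y} (h : ModOn (g '' L) φ) :
    ModOn L (fun ε y => φ ε (g y)) := by
  obtain ⟨b, C, hC⟩ := h
  exact ⟨b, C, hC.mono fun ε hε y hy => hε _ (mem_image_of_mem g hy)⟩

theorem NegOn.image {Y : Type*} {g : Y → X} {L : Set Y} (h : NegOn (g '' L) φ) :
    NegOn L (fun ε y => φ ε (g y)) := by
  intro a ha
  obtain ⟨C, hC⟩ := h a ha
  exact ⟨C, hC.mono fun ε hε y hy => hε _ (mem_image_of_mem g hy)⟩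

end Landau

/-! ### Generalized numbers -/

/-- The ring of moderate nets of real numbers. -/
def moderateNumbers : Subring (Eps → ℝ) where
  carrier := {r | ∃ b C : ℝ, ∀ᶠ ε in toZero, |r ε| ≤ C * (ε : ℝ) ^ b}
  mul_mem' {r s} hr hs := by
    have h : ∀ r : Eps → ℝ, (∃ b C : ℝ, ∀ᶠ ε in toZero, |r ε| ≤ C * (ε : ℝ) ^ b) ↔
      ModOn (univ : Set Unit) (fun ε _ => r ε) := fun r => by simp [ModOn, UnifBigO]
    exact (h _).2 (((h _).1 hr).mul ((h _).1 hs))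
  one_mem' := ⟨0, 1, Eventually.of_forall fun ε => by simp⟩
  add_mem' {r s} hr hs := by
    have h : ∀ r : Eps → ℝ, (∃ b C : ℝ, ∀ᶠ ε in toZero, |r ε| ≤ C * (ε : ℝ) ^ b) ↔
      ModOn (univ : Set Unit) (fun ε _ => r ε) := fun r => by simp [ModOn, UnifBigO]
    exact (h _).2 (((h _).1 hr).add ((h _).1 hs))
  zero_mem' := ⟨0, 0, Eventually.of_forall fun ε => by simp⟩
  neg_mem' {r} hr := by
    obtain ⟨b, C, hC⟩ := hr
    exact ⟨b, C, hC.mono fun ε hε => by simpa using hε⟩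

/-- The ideal of negligible nets of real numbers. -/
def negligibleNumbers : Ideal moderateNumbers where
  carrier := {r | ∀ a : ℝ, 0 ≤ a → ∃ C : ℝ, ∀ᶠ ε in toZero, |r.1 ε| ≤ C * (ε : ℝ) ^ a}
  add_mem' {r s} hr hs := by
    intro a ha
    obtain ⟨C, hC⟩ := hr a ha
    obtain ⟨D, hD⟩ := hs a ha
    refine ⟨C + D, (hC.and hD).mono fun ε hε => ?_⟩
    calc |r.1 ε + s.1 ε| ≤ |r.1 ε| + |s.1 ε| := abs_add_le _ _
      _ ≤ C * (ε : ℝ) ^ a + D * (ε : ℝ) ^ a := add_le_add hε.1 hε.2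
      _ = _ := by ring
  zero_mem' := fun a _ => ⟨0, Eventually.of_forall fun ε => by simp⟩
  smul_mem' r s hs := by
    have h1 : ModOn (univ : Set Unit) (fun ε _ => r.1 ε) := by
      obtain ⟨b, C, hC⟩ := r.2
      exact ⟨b, C, hC.mono fun ε hε _ _ => hε⟩
    have h2 : NegOn (univ : Set Unit) (fun ε _ => s.1 ε) := by
      simpa [NegOn, UnifBigO] using hs
    simpa [NegOn, UnifBigO] using h1.mul_negOn h2

/-- The Colombeau ring of generalized numbers. -/
abbrev GenNumber : Type := moderateNumbers ⧸ negligibleNumbers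

/-- The generalized number with representative `(ε)_{ε ∈ (0,1]}`. -/
def epsNumber : GenNumber :=
  Ideal.Quotient.mk negligibleNumbers
    ⟨fun ε => (ε : ℝ), 1, 1, Eventually.of_forall fun ε => by
      simp [abs_of_pos ε.2.1]⟩

/-! ### The special Colombeau algebra -/

section Algebra

/-- Sets on which generalized functions live. Unique differentiability covers open sets, closures
such as the strip `[0,T] × ℝ`, and the relatively open subsets of these; on them `ContDiffOn ℝ ∞`
describes the functions all of whose derivatives extend continuously up to the part of the boundary
that belongs to the set, and `iteratedFDerivWithin` gives the extended derivatives. -/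
structure Domain (E : Type*) [NormedAddCommGroup E] [NormedSpace ℝ E] where
  /-- the underlying set -/
  carrier : Set E
  uniqueDiffOn : UniqueDiffOn ℝ carrier

variable {E : Type*} [NormedAddCommGroup E] [NormedSpace ℝ E]
variable {F : Type*} [NormedAddCommGroup F] [NormedSpace ℝ F]

/-- The relatively open subset `S ∩ O` of `S`. -/
def Domain.interOpen (S : Domain E) (O : TopologicalSpace.Opens E) : Domain E where
  carrier := S.carrier ∩ O
  uniqueDiffOn := S.uniqueDiffOn.inter O.isOpen

/-- The size of the `k`-th derivatives of the members of a net on `S`. -/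
noncomputable def derivSize (S : Domain E) (u : Eps → E → ℝ) (k : ℕ) : Eps → E → ℝ :=
  fun ε x => ‖iteratedFDerivWithin ℝ k (u ε) S.carrier x‖

/-- Nets of smooth functions on `S`; the values outside `S` play no role. -/
def IsSmoothNet (S : Domain E) (u : Eps → E → ℝ) : Prop :=
  ∀ ε, ContDiffOn ℝ ∞ (u ε) S.carrier

theorem derivSize_add_le {S : Domain E} {u v : Eps → E → ℝ} (hu : IsSmoothNet S u)
    (hv : IsSmoothNet S v) (k : ℕ) (ε : Eps) {x : E} (hx : x ∈ S.carrier) :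
    derivSize S (u + v) k ε x ≤ derivSize S u k ε x + derivSize S v k ε x := by
  have hk : ((k : ℕ∞) : WithTop ℕ∞) ≤ ∞ := by exact_mod_cast le_top
  unfold derivSize
  rw [Pi.add_apply, iteratedFDerivWithin_add_apply ((hu ε x hx).of_le hk)
    ((hv ε x hx).of_le hk) S.uniqueDiffOn hx]
  exact norm_add_le _ _

theorem derivSize_neg {S : Domain E} {u : Eps → E → ℝ} (k : ℕ) (ε : Eps) {x : E}
    (hx : x ∈ S.carrier) : derivSize S (-u) k ε x = derivSize S u k ε x := by
  unfold derivSize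
  rw [Pi.neg_apply, iteratedFDerivWithin_neg_apply S.uniqueDiffOn hx, norm_neg]

theorem derivSize_mul_le {S : Domain E} {u v : Eps → E → ℝ} (hu : IsSmoothNet S u)
    (hv : IsSmoothNet S v) (k : ℕ) (ε : Eps) {x : E} (hx : x ∈ S.carrier) :
    derivSize S (u * v) k ε x ≤ ∑ i ∈ Finset.range (k + 1),
      (k.choose i : ℝ) * derivSize S u i ε x * derivSize S v (k - i) ε x :=
  norm_iteratedFDerivWithin_mul_le (hu ε) (hv ε) S.uniqueDiffOn hx
    (n := k) (by exact_mod_cast le_top)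

theorem derivSize_nonneg (S : Domain E) (u : Eps → E → ℝ) (k : ℕ) (ε : Eps) (x : E) :
    0 ≤ derivSize S u k ε x := norm_nonneg _

theorem abs_le_abs_of_derivSize_le {S : Domain E} {u : Eps → E → ℝ} {k : ℕ} {ε : Eps} {x : E}
    {r : ℝ} (h : derivSize S u k ε x ≤ r) : |derivSize S u k ε x| ≤ |r| :=
  abs_le_abs_of_nonneg (derivSize_nonneg S u k ε x) h

/-- All derivatives are moderate on every compact subset of `S`. -/
def ModerateNet (S : Domain E) (u : Eps → E → ℝ) : Prop :=
  ∀ K ⊆ S.carrier, IsCompact K → ∀ k : ℕ, ModOn K (derivSize S u k)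

/-- All derivatives are negligible on every compact subset of `S`. -/
def NegligibleNet (S : Domain E) (u : Eps → E → ℝ) : Prop :=
  ∀ K ⊆ S.carrier, IsCompact K → ∀ k : ℕ, NegOn K (derivSize S u k)

theorem derivSize_const (S : Domain E) (r : Eps → ℝ) (k : ℕ) (ε : Eps) (x : E) :
    derivSize S (fun ε _ => r ε) k ε x = if k = 0 then |r ε| else 0 := by
  unfold derivSize
  split_ifs with hk
  · subst hk; simp
  · simp [iteratedFDerivWithin_const_of_ne hk]

/-- The algebra `ℰ_M(S)` of moderate nets of smooth functions. -/
noncomputable def moderateNets (S : Domain E) : Subring (Eps → E → ℝ) where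
  carrier := {u | IsSmoothNet S u ∧ ModerateNet S u}
  mul_mem' {u v} hu hv := by
    refine ⟨fun ε => (hu.1 ε).mul (hv.1 ε), fun K hKS hK k => ?_⟩
    refine ModOn.of_le (ModOn.sum (Finset.range (k + 1)) (fun i _ =>
      ((modOn_const (k.choose i : ℝ)).mul (hu.2 K hKS hK i)).mul (hv.2 K hKS hK (k - i)))) ?_
    exact fun ε x hx => abs_le_abs_of_derivSize_le (derivSize_mul_le hu.1 hv.1 k ε (hKS hx))
  one_mem' := by
    refine ⟨fun ε => contDiffOn_const, fun K _ _ k => ?_⟩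
    refine (modOn_const 1).of_le fun ε x _ => ?_
    have := derivSize_const S (fun _ => 1) k ε x
    change |derivSize S (fun _ _ => 1) k ε x| ≤ _
    rw [this]
    split_ifs <;> simp
  add_mem' {u v} hu hv := by
    refine ⟨fun ε => (hu.1 ε).add (hv.1 ε), fun K hKS hK k => ?_⟩
    refine ((hu.2 K hKS hK k).add (hv.2 K hKS hK k)).of_le ?_
    exact fun ε x hx => abs_le_abs_of_derivSize_le (derivSize_add_le hu.1 hv.1 k ε (hKS hx))
  zero_mem' := by
    refine ⟨fun ε => contDiffOn_const, fun K _ _ k => ?_⟩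
    refine (modOn_const 0).of_le fun ε x _ => ?_
    have := derivSize_const S (fun _ => 0) k ε x
    change |derivSize S (fun _ _ => 0) k ε x| ≤ _
    rw [this]
    split_ifs <;> simp
  neg_mem' {u} hu := by
    refine ⟨fun ε => (hu.1 ε).neg, fun K hKS hK k => ?_⟩
    exact (hu.2 K hKS hK k).of_le fun ε x hx => by rw [derivSize_neg k ε (hKS hx)]

/-- The ideal `𝒩(S)` of negligible nets. -/
noncomputable def negligibleNets (S : Domain E) : Ideal (moderateNets S) where
  carrier := {u | NegligibleNet S u.1}
  add_mem' {u v} hu hv := by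
    intro K hKS hK k
    refine ((hu K hKS hK k).add (hv K hKS hK k)).of_le ?_
    exact fun ε x hx =>
      abs_le_abs_of_derivSize_le (derivSize_add_le u.2.1 v.2.1 k ε (hKS hx))
  zero_mem' := by
    intro K _ _ k
    refine negOn_zero.of_le fun ε x _ => ?_
    have := derivSize_const S (fun _ => 0) k ε x
    change |derivSize S (fun _ _ => 0) k ε x| ≤ _
    rw [this]
    split_ifs <;> simp
  smul_mem' u v hv := by
    intro K hKS hK k
    refine NegOn.of_le (NegOn.sum (Finset.range (k + 1)) (fun i _ =>
      ((modOn_const (k.choose i : ℝ)).mul (u.2.2 K hKS hK i)).mul_negOn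
        (hv K hKS hK (k - i)))) ?_
    exact fun ε x hx =>
      abs_le_abs_of_derivSize_le (derivSize_mul_le u.2.1 v.2.1 k ε (hKS hx))

/-- The special Colombeau algebra `𝒢(S) = ℰ_M(S) / 𝒩(S)`. -/
abbrev GenFun (S : Domain E) : Type _ := moderateNets S ⧸ negligibleNets S

/-- The class of a moderate net. -/
noncomputable abbrev GenFun.mk (S : Domain E) : moderateNets S →+* GenFun S :=
  Ideal.Quotient.mk (negligibleNets S)

/-- Maps defined on representatives and compatible with negligible differences. -/
noncomputable def GenFun.lift {S : Domain E} {S' : Domain F} (Φ : moderateNets S → moderateNets S')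
    (h : ∀ u v, u - v ∈ negligibleNets S → Φ u - Φ v ∈ negligibleNets S') :
    GenFun S → GenFun S' :=
  Quotient.lift (fun u => GenFun.mk S' (Φ u)) fun u v huv =>
    Ideal.Quotient.eq.2 (h u v ((Submodule.quotientRel_def _).1 huv))

theorem GenFun.lift_mk {S : Domain E} {S' : Domain F} (Φ : moderateNets S → moderateNets S')
    (h : ∀ u v, u - v ∈ negligibleNets S → Φ u - Φ v ∈ negligibleNets S') (u : moderateNets S) :
    GenFun.lift Φ h (GenFun.mk S u) = GenFun.mk S' (Φ u) := rfl

/-- `U` is of bounded type on `L`: some representative is `O(1)` uniformly on `L`. -/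
def BoundedTypeOn {S : Domain E} (U : GenFun S) (L : Set E) : Prop :=
  ∃ u : moderateNets S, GenFun.mk S u = U ∧
    ∃ C : ℝ, ∀ᶠ ε in toZero, ∀ x ∈ L, |u.1 ε x| ≤ C

/-! #### Generalized numbers as constants -/

theorem const_mem_moderateNets (S : Domain E) (r : moderateNumbers) :
    (fun ε (_ : E) => r.1 ε) ∈ moderateNets S := by
  refine ⟨fun ε => contDiffOn_const, fun K _ _ k => ?_⟩
  obtain ⟨b, C, hC⟩ := r.2
  refine ModOn.of_le (ψ := fun ε _ => r.1 ε) ⟨b, C, hC.mono fun ε hε x _ => hε⟩ fun ε x _ => ?_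
  rw [derivSize_const S r.1 k ε x]
  split_ifs <;> simp

/-- The canonical ring homomorphism from generalized numbers to `𝒢(S)`. -/
noncomputable def ofNumber (S : Domain E) : GenNumber →+* GenFun S :=
  Ideal.Quotient.lift negligibleNumbers
    ((GenFun.mk S).comp
      { toFun := fun r => ⟨fun ε _ => r.1 ε, const_mem_moderateNets S r⟩
        map_one' := rfl
        map_mul' := fun _ _ => rfl
        map_zero' := rfl
        map_add' := fun _ _ => rfl })
    (fun r hr => by
      refine Ideal.Quotient.eq_zero_iff_mem.2 fun K _ _ k => ?_
      refine NegOn.of_le (ψ := fun ε _ => r.1 ε) (fun a ha => ?_) fun ε x _ => ?_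
      · obtain ⟨C, hC⟩ := hr a ha
        exact ⟨C, hC.mono fun ε hε x _ => hε⟩
      · change |derivSize S (fun ε _ => r.1 ε) k ε x| ≤ _
        rw [derivSize_const S r.1 k ε x]
        split_ifs <;> simp)

/-! #### Derivatives -/

/-- The net of derivatives in direction `v`. -/
noncomputable def derivNet (S : Domain E) (v : E) (u : Eps → E → ℝ) : Eps → E → ℝ :=
  fun ε x => fderivWithin ℝ (u ε) S.carrier x v

theorem IsSmoothNet.fderivWithin {S : Domain E} {u : Eps → E → ℝ} (hu : IsSmoothNet S u)
    (ε : Eps) : ContDiffOn ℝ ∞ (fderivWithin ℝ (u ε) S.carrier) S.carrier :=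
  (hu ε).fderivWithin S.uniqueDiffOn (by simp)

theorem derivSize_derivNet_le {S : Domain E} (v : E) {u : Eps → E → ℝ} (hu : IsSmoothNet S u)
    (k : ℕ) (ε : Eps) {x : E} (hx : x ∈ S.carrier) :
    derivSize S (derivNet S v u) k ε x ≤ ‖v‖ * derivSize S u (k + 1) ε x := by
  unfold derivSize derivNet
  rw [← norm_iteratedFDerivWithin_fderivWithin S.uniqueDiffOn hx]
  exact norm_iteratedFDerivWithin_clm_apply_const (hu.fderivWithin ε x hx) S.uniqueDiffOn hx
    (n := k) (by exact_mod_cast le_top)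

theorem derivNet_mem {S : Domain E} (v : E) (u : moderateNets S) :
    derivNet S v u.1 ∈ moderateNets S := by
  refine ⟨fun ε => (u.2.1.fderivWithin ε).clm_apply contDiffOn_const, fun K hKS hK k => ?_⟩
  exact ((modOn_const ‖v‖).mul (u.2.2 K hKS hK (k + 1))).of_le fun ε x hx =>
    abs_le_abs_of_derivSize_le (derivSize_derivNet_le v u.2.1 k ε (hKS hx))

theorem derivSize_congr {S : Domain E} {u v : Eps → E → ℝ}
    (h : ∀ ε, ∀ x ∈ S.carrier, u ε x = v ε x) (k : ℕ) (ε : Eps) {x : E} (hx : x ∈ S.carrier) :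
    derivSize S u k ε x = derivSize S v k ε x := by
  unfold derivSize
  rw [iteratedFDerivWithin_congr (fun y hy => h ε y hy) hx]

/-- The derivative of a generalized function in direction `v`. -/
noncomputable def partialD {S : Domain E} (v : E) : GenFun S → GenFun S :=
  GenFun.lift (fun u => ⟨derivNet S v u.1, derivNet_mem v u⟩) fun u w huw K hKS hK k => by
    refine NegOn.of_le ((modOn_const ‖v‖).mul_negOn (huw K hKS hK (k + 1))) fun ε x hx => ?_
    refine abs_le_abs_of_derivSize_le (le_of_eq_of_le ?_
      (derivSize_derivNet_le v (u - w).2.1 k ε (hKS hx)))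
    refine derivSize_congr (fun ε y hy => ?_) k ε (hKS hx)
    change fderivWithin ℝ (u.1 ε) S.carrier y v - fderivWithin ℝ (w.1 ε) S.carrier y v =
      fderivWithin ℝ (u.1 ε - w.1 ε) S.carrier y v
    rw [fderivWithin_sub (S.uniqueDiffOn y hy) ((u.2.1 ε).differentiableOn (by simp) y hy)
      ((w.2.1 ε).differentiableOn (by simp) y hy)]
    rfl

/-- `U ∈ 𝒢⁰(S)`: all derivatives of `U` of any order are of bounded type on compact sets.
Derivatives of order `n` are taken along arbitrary lists of `n` directions. -/
def IsG0 {S : Domain E} (U : GenFun S) : Prop :=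
  ∀ vs : List E, ∀ K ⊆ S.carrier, IsCompact K → BoundedTypeOn (vs.foldr partialD U) K

/-! #### Restrictions -/

theorem derivSize_interOpen (S : Domain E) (O : TopologicalSpace.Opens E) (u : Eps → E → ℝ)
    (k : ℕ) (ε : Eps) {x : E} (hx : x ∈ O) :
    derivSize (S.interOpen O) u k ε x = derivSize S u k ε x := by
  unfold derivSize Domain.interOpen
  rw [iteratedFDerivWithin_inter_open O.isOpen hx]

theorem restrict_mem {S : Domain E} (O : TopologicalSpace.Opens E) (u : moderateNets S) :
    u.1 ∈ moderateNets (S.interOpen O) := by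
  refine ⟨fun ε => (u.2.1 ε).mono inter_subset_left, fun K hKS hK k => ?_⟩
  exact (u.2.2 K (hKS.trans inter_subset_left) hK k).of_le fun ε x hx => by
    rw [derivSize_interOpen S O u.1 k ε (hKS hx).2]

/-- Restriction of generalized functions to relatively open subsets. -/
noncomputable def restrictTo {S : Domain E} (O : TopologicalSpace.Opens E) :
    GenFun S → GenFun (S.interOpen O) :=
  GenFun.lift (fun u => ⟨u.1, restrict_mem O u⟩) fun u v huv K hKS hK k =>
    (huv K (hKS.trans inter_subset_left) hK k).of_le fun ε _ hx =>
      (congrArg abs (derivSize_interOpen S O (u.1 - v.1) k ε (hKS hx).2)).le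

/-- The support of `U`: the complement in `S` of the largest relatively open subset on which
`U` vanishes. -/
def supp {S : Domain E} (U : GenFun S) : Set E :=
  S.carrier \ ⋃ (O : TopologicalSpace.Opens E) (_ : restrictTo O U = 0), (O : Set E)

/-- The `𝒢⁰`-singular support of `U`: the complement in `S` of the largest relatively open subset
on which `U` belongs to `𝒢⁰`. -/
def singSuppG0 {S : Domain E} (U : GenFun S) : Set E :=
  S.carrier \ ⋃ (O : TopologicalSpace.Opens E) (_ : IsG0 (restrictTo O U)), (O : Set E)

theorem derivSize_comp_le {S : Domain E} {S' : Domain F} (g : F →L[ℝ] E)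
    (hg : g ⁻¹' S.carrier = S'.carrier) {u : Eps → E → ℝ} (hu : IsSmoothNet S u)
    (k : ℕ) (ε : Eps) {y : F} (hy : y ∈ S'.carrier) :
    derivSize S' (fun ε y => u ε (g y)) k ε y ≤ derivSize S u k ε (g y) * ‖g‖ ^ k := by
  unfold derivSize
  have h' : UniqueDiffOn ℝ (g ⁻¹' S.carrier) := hg ▸ S'.uniqueDiffOn
  have hy' : g y ∈ S.carrier := by rw [← hg] at hy; exact hy
  have := g.iteratedFDerivWithin_comp_right (hu ε) S.uniqueDiffOn h' hy' (i := k)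
    (by exact_mod_cast le_top)
  rw [hg] at this
  change ‖iteratedFDerivWithin ℝ k (u ε ∘ g) S'.carrier y‖ ≤ _
  rw [this]
  refine (ContinuousMultilinearMap.norm_compContinuousLinearMap_le _ _).trans_eq ?_
  simp

theorem pullback_mem {S : Domain E} {S' : Domain F} (g : F →L[ℝ] E)
    (hg : g ⁻¹' S.carrier = S'.carrier) (u : moderateNets S) :
    (fun ε y => u.1 ε (g y)) ∈ moderateNets S' := by
  refine ⟨fun ε => (u.2.1 ε).comp g.contDiff.contDiffOn (by rw [← hg]; exact fun _ h => h),
    fun K hKS hK k => ?_⟩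
  have hsub : g '' K ⊆ S.carrier := image_subset_iff.2 (hg ▸ hKS)
  exact ((u.2.2 (g '' K) hsub (hK.image g.continuous) k).image.mul (modOn_const (‖g‖ ^ k))).of_le
    fun ε x hx => abs_le_abs_of_derivSize_le (derivSize_comp_le g hg u.2.1 k ε (hKS hx))

/-- Pullback under a linear map `g`; with `g` the embedding of a linear subspace this is the
restriction to that subspace. -/
noncomputable def pullback {S : Domain E} {S' : Domain F} (g : F →L[ℝ] E)
    (hg : g ⁻¹' S.carrier = S'.carrier) : GenFun S → GenFun S' :=
  GenFun.lift (fun u => ⟨fun ε y => u.1 ε (g y), pullback_mem g hg u⟩) fun u v huv K hKS hK k => by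
    have hsub : g '' K ⊆ S.carrier := image_subset_iff.2 (hg ▸ hKS)
    exact ((huv (g '' K) hsub (hK.image g.continuous) k).image.mul_modOn
      (modOn_const (‖g‖ ^ k))).of_le fun ε x hx =>
        abs_le_abs_of_derivSize_le (derivSize_comp_le g hg (u - v).2.1 k ε (hKS hx))

/-! #### Superposition -/

/-- `f ∈ 𝒪_M(ℝ)`: `f` is smooth and each derivative grows at most polynomially. -/
def IsOM (f : ℝ → ℝ) : Prop :=
  ContDiff ℝ ∞ f ∧ ∀ k : ℕ, ∃ (C : ℝ) (N : ℕ), ∀ y, |iteratedDeriv k f y| ≤ C * (1 + |y|) ^ N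

theorem isOM_deriv {f : ℝ → ℝ} (hf : IsOM f) : IsOM (deriv f) := by
  refine ⟨(contDiff_infty_iff_deriv.1 hf.1).2, fun k => ?_⟩
  rw [← iteratedDeriv_succ']
  exact hf.2 (k + 1)

theorem modOn_abs {S : Domain E} {u : Eps → E → ℝ} {K : Set E} (h : ModOn K (derivSize S u 0)) :
    ModOn K (fun ε x => |u ε x|) :=
  h.of_le fun ε x _ => by simp [derivSize]

theorem IsOM.comp_mem {f : ℝ → ℝ} (hf : IsOM f) {S : Domain E} (u : moderateNets S) :
    (fun ε x => f (u.1 ε x)) ∈ moderateNets S := by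
  refine ⟨fun ε => hf.1.comp_contDiffOn (u.2.1 ε), fun K hKS hK k => ?_⟩
  choose C N hCN using hf.2
  have h1 : ∀ i, ModOn K (fun ε x => |C i| * (1 + |u.1 ε x|) ^ N i) := fun i =>
    (modOn_const _).mul (((modOn_const 1).add (modOn_abs (u.2.2 K hKS hK 0))).pow _)
  have hA := ModOn.sum (Finset.range (k + 1)) (fun i _ => h1 i)
  have hD := (modOn_const (K := K) 1).add
    (ModOn.sum (Finset.range (k + 1)) (fun i _ => u.2.2 K hKS hK i))
  refine (((modOn_const (k.factorial : ℝ)).mul hA).mul (hD.pow k)).of_le fun ε x hx => ?_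
  refine abs_le_abs_of_derivSize_le ?_
  refine norm_iteratedFDerivWithin_comp_le (N := ∞) (t := univ) hf.1.contDiffOn (u.2.1 ε)
    (by exact_mod_cast le_top) uniqueDiffOn_univ S.uniqueDiffOn (mapsTo_univ _ _) (hKS hx) ?_ ?_
  · intro i hi
    rw [iteratedFDerivWithin_univ, norm_iteratedFDeriv_eq_norm_iteratedDeriv, Real.norm_eq_abs]
    refine (hCN i _).trans ?_
    have h2 : C i * (1 + |u.1 ε x|) ^ N i ≤ |C i| * (1 + |u.1 ε x|) ^ N i := by
      gcongr; exact le_abs_self _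
    exact h2.trans (Finset.single_le_sum
      (f := fun i => |C i| * (1 + |u.1 ε x|) ^ N i) (fun j _ => by positivity)
      (Finset.mem_range.2 (Nat.lt_succ_of_le hi)))
  · intro i hi1 hi
    have h3 : derivSize S u.1 i ε x ≤ ∑ i ∈ Finset.range (k + 1), derivSize S u.1 i ε x :=
      Finset.single_le_sum (f := fun i => derivSize S u.1 i ε x)
        (fun j _ => derivSize_nonneg S u.1 j ε x) (Finset.mem_range.2 (Nat.lt_succ_of_le hi))
    have h4 := derivSize_nonneg S u.1 i ε x
    change derivSize S u.1 i ε x ≤ _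
    exact (h3.trans (by linarith)).trans (le_self_pow₀ (by linarith) (by omega))

theorem IsOM.abs_sub_le {f : ℝ → ℝ} (hf : IsOM f) : ∃ (C : ℝ) (N : ℕ), ∀ y z,
    |f y - f z| ≤ C * (1 + (|y| + |z|)) ^ N * |y - z| := by
  obtain ⟨C, N, h⟩ := hf.2 1
  refine ⟨|C|, N, fun y z => ?_⟩
  have := Convex.norm_image_sub_le_of_norm_deriv_le (f := f) (s := Set.Icc (-(|y| + |z|)) (|y| + |z|))
    (C := |C| * (1 + (|y| + |z|)) ^ N) (x := z) (y := y)
    (fun x _ => (hf.1.differentiable (by simp)) x) (fun x hx => ?_) (convex_Icc _ _) ?_ ?_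
  · simpa using this
  · have h1 := h x
    rw [iteratedDeriv_one] at h1
    rw [Real.norm_eq_abs]
    refine h1.trans ?_
    have : |x| ≤ |y| + |z| := abs_le.2 hx
    gcongr
    exact le_abs_self C
  · exact abs_le.1 (by linarith [abs_nonneg y])
  · exact abs_le.1 (by linarith [abs_nonneg z])

theorem IsOM.comp_sub_negligible {S : Domain E} (u v : moderateNets S)
    (huv : u - v ∈ negligibleNets S) {K : Set E} (hKS : K ⊆ S.carrier) (hK : IsCompact K)
    (k : ℕ) : ∀ {f : ℝ → ℝ}, IsOM f →
      NegOn K (derivSize S (fun ε x => f (u.1 ε x) - f (v.1 ε x)) k) := by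
  induction k using Nat.strong_induction_on with
  | _ k ih =>
  intro f hf
  rcases k with _ | k
  · obtain ⟨C, N, h⟩ := hf.abs_sub_le
    have h0 : NegOn K (fun ε x => |u.1 ε x - v.1 ε x|) :=
      (huv K hKS hK 0).of_le fun ε x _ => by simp [derivSize]
    refine NegOn.of_le (((modOn_const C).mul (((modOn_const 1).add
      ((modOn_abs (u.2.2 K hKS hK 0)).add (modOn_abs (v.2.2 K hKS hK 0)))).pow N)).mul_negOn h0) ?_
    intro ε x _
    refine abs_le_abs_of_derivSize_le ?_
    simpa [derivSize] using h (u.1 ε x) (v.1 ε x)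
  · have hsm : ∀ w : moderateNets S, IsSmoothNet S (fun ε x => deriv f (w.1 ε x)) := fun w =>
      ((isOM_deriv hf).comp_mem w).1
    have key : NegOn K (fun ε x =>
        (∑ i ∈ Finset.range (k + 1), (k.choose i : ℝ) *
          derivSize S (fun ε x => deriv f (u.1 ε x) - deriv f (v.1 ε x)) i ε x *
          derivSize S u.1 (k - i + 1) ε x) +
        ∑ i ∈ Finset.range (k + 1), (k.choose i : ℝ) *
          derivSize S (fun ε x => deriv f (v.1 ε x)) i ε x *
          derivSize S (u.1 - v.1) (k - i + 1) ε x) := by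
      refine NegOn.add (NegOn.sum _ fun i hi => ?_) (NegOn.sum _ fun i _ => ?_)
      · exact ((modOn_const _).mul_negOn (ih i (Finset.mem_range.1 hi) (isOM_deriv hf))).mul_modOn
          (u.2.2 K hKS hK _)
      · exact ((modOn_const _).mul (((isOM_deriv hf).comp_mem v).2 K hKS hK i)).mul_negOn
          (huv K hKS hK _)
    refine key.of_le fun ε x hx => abs_le_abs_of_derivSize_le ?_
    have hxS := hKS hx
    have hdu : ∀ w : moderateNets S, ∀ y ∈ S.carrier,
        DifferentiableWithinAt ℝ (w.1 ε) S.carrier y := fun w y hy =>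
      (w.2.1 ε).differentiableOn (by simp) y hy
    have hcomp : ∀ w : moderateNets S, ∀ y ∈ S.carrier,
        HasFDerivWithinAt (fun x => f (w.1 ε x))
          (deriv f (w.1 ε y) • fderivWithin ℝ (w.1 ε) S.carrier y) S.carrier y := fun w y hy =>
      ((hf.1.differentiable (by simp)) (w.1 ε y)).hasDerivAt.comp_hasFDerivWithinAt y
        (hdu w y hy).hasFDerivWithinAt
    have heq : EqOn (fderivWithin ℝ (fun x => f (u.1 ε x) - f (v.1 ε x)) S.carrier)
        ((fun y => (deriv f (u.1 ε y) - deriv f (v.1 ε y)) •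
          fderivWithin ℝ (u.1 ε) S.carrier y) +
         (fun y => deriv f (v.1 ε y) • fderivWithin ℝ (u.1 ε - v.1 ε) S.carrier y)) S.carrier := by
      intro y hy
      have h1 := ((hcomp u y hy).sub (hcomp v y hy)).fderivWithin (S.uniqueDiffOn y hy)
      have h2 := fderivWithin_sub (S.uniqueDiffOn y hy) (hdu u y hy) (hdu v y hy)
      refine h1.trans ?_
      simp only [Pi.add_apply]
      rw [h2]
      module
    have hsd : ContDiffOn ℝ ∞ (fun y => deriv f (u.1 ε y) - deriv f (v.1 ε y)) S.carrier :=
      (hsm u ε).sub (hsm v ε)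
    have hw : ContDiffOn ℝ ∞ (fderivWithin ℝ (u.1 ε - v.1 ε) S.carrier) S.carrier :=
      IsSmoothNet.fderivWithin (u - v).2.1 ε
    have hs1 : ContDiffOn ℝ ∞ (fun y => (deriv f (u.1 ε y) - deriv f (v.1 ε y)) •
        fderivWithin ℝ (u.1 ε) S.carrier y) S.carrier := hsd.smul (u.2.1.fderivWithin ε)
    have hs2 : ContDiffOn ℝ ∞ (fun y => deriv f (v.1 ε y) •
        fderivWithin ℝ (u.1 ε - v.1 ε) S.carrier y) S.carrier := (hsm v ε).smul hw
    have hk : ((k : ℕ∞) : WithTop ℕ∞) ≤ ∞ := by exact_mod_cast le_top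
    unfold derivSize
    rw [← norm_iteratedFDerivWithin_fderivWithin S.uniqueDiffOn hxS,
      iteratedFDerivWithin_congr heq hxS,
      iteratedFDerivWithin_add_apply
        ((hs1 x hxS).of_le hk) ((hs2 x hxS).of_le hk) S.uniqueDiffOn hxS]
    refine (norm_add_le _ _).trans (add_le_add ?_ ?_)
    · refine (norm_iteratedFDerivWithin_smul_le hsd (u.2.1.fderivWithin ε) S.uniqueDiffOn hxS
        (n := k) (by exact_mod_cast le_top)).trans_eq ?_
      refine Finset.sum_congr rfl fun i _ => ?_
      rw [norm_iteratedFDerivWithin_fderivWithin S.uniqueDiffOn hxS]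
    · refine (norm_iteratedFDerivWithin_smul_le (hsm v ε) hw S.uniqueDiffOn hxS
        (n := k) (by exact_mod_cast le_top)).trans_eq ?_
      refine Finset.sum_congr rfl fun i _ => ?_
      rw [norm_iteratedFDerivWithin_fderivWithin S.uniqueDiffOn hxS]
      rfl

/-- The superposition `f(U)` of `U ∈ 𝒢(S)` with `f ∈ 𝒪_M(ℝ)`. -/
noncomputable def superpose {S : Domain E} (f : ℝ → ℝ) (hf : IsOM f) : GenFun S → GenFun S :=
  GenFun.lift (fun u => ⟨fun ε x => f (u.1 ε x), hf.comp_mem u⟩) fun u v huv _ hKS hK k =>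
    IsOM.comp_sub_negligible u v huv hKS hK k hf

end Algebra

/-! ### The line and the strip -/

/-- The real line. -/
def line : Domain ℝ where
  carrier := univ
  uniqueDiffOn := uniqueDiffOn_univ

/-- The strip `[0,T] × ℝ` of points `(t,x)`. -/
def strip (T : ℝ) (hT : 0 < T) : Domain (ℝ × ℝ) where
  carrier := Icc 0 T ×ˢ univ
  uniqueDiffOn := (uniqueDiffOn_Icc hT).prod uniqueDiffOn_univ

/-- The punctured line as an open subset of `ℝ`. -/
def puncturedLine : TopologicalSpace.Opens ℝ := ⟨{0}ᶜ, isOpen_compl_singleton⟩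

/-- The restriction `U|_{t=0}` to the initial line. -/
noncomputable def initialValue {T : ℝ} {hT : 0 < T} : GenFun (strip T hT) → GenFun line :=
  pullback (ContinuousLinearMap.inr ℝ ℝ ℝ) (by
    ext x
    simp [strip, line, hT.le])

/-- The derivative `∂_t`. -/
noncomputable def dt {T : ℝ} {hT : 0 < T} : GenFun (strip T hT) → GenFun (strip T hT) :=
  partialD (1, 0)

/-- The derivative `∂_x`. -/
noncomputable def dx {T : ℝ} {hT : 0 < T} : GenFun (strip T hT) → GenFun (strip T hT) :=
  partialD (0, 1)

/-- The derivative on the line. -/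
noncomputable def ddx : GenFun line → GenFun line := partialD 1

end Colombeau

open Colombeau

/-!
The factor `ε` in front of `f(U)` is used only for existence; the regularity statement comes from
the structure of the semilinear wave equation in one space dimension.

*Existence.* The supports being compact, the data have representatives `v₀`, `v₁` that vanish
outside a fixed compact set (`exists_rep_eq_zero`). For small `ε` these are bounded uniformly in
`ε`, because `U₀'` and `U₁` are of bounded type. Hence the solutions of the linear wave equation with
these data are bounded on the strip by a constant `C`. Let `g` be smooth with compact support and
equal to `f` on `[-C-1, C+1]`. In characteristic coordinates `p = x + t`, `q = x - t` the equation
with `g` in place of `f` is an integral equation with the operator `triInt`, which for small `ε` is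
solved by contraction (`exists_fixedPoint_triInt`). As `triInt` gains one derivative, the solution
is smooth. The solutions `u` differ from the linear ones by `O(ε)` on the strip, so `g(u) = f(u)`
for small `ε`.

*Estimates.* Since the derivatives along the two characteristic directions satisfy
`∂_q ∂_p u = -(ε/4) g(u)`, the derivative of `∂_pⁿ⁺¹ u` along a line `p = const` is
`-(ε/4) ∂_pⁿ (g(u))`, which contains only derivatives `∂_pʲ u` with `j ≤ n` on the same line. So
bounds for the derivatives of the data at the point where the line meets `t = 0` are propagated
along the line by induction on `n`, and no estimate for the other characteristics is needed
(`IsWaveNet.jetTame_char`). Mixed derivatives are reduced to pure ones by the equation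
(`IsWaveNet.jetTame_of_char`), and the derivatives at `t = 0` to those of `v₀`, `v₁`
(`IsWaveNet.jetTame_initial`). This argument is carried out once, for `TameOn m`. With `m = 1` it
shows that `u` is moderate. With `m = 0` it shows that all derivatives of `u` are of bounded type on
the compact sets on which neither `x + t` nor `x - t` vanishes, because the data are in `𝒢⁰` off the
origin.
-/

namespace Colombeau

open MeasureTheory intervalIntegral

/-! ### Integrals along characteristics -/

theorem hasFDerivAt_of_partials {F A B : ℝ × ℝ → ℝ} (hA : Continuous A) (hB : Continuous B)
    (hFA : ∀ p q, HasDerivAt (fun r => F (r, q)) (A (p, q)) p)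
    (hFB : ∀ p q, HasDerivAt (fun s => F (p, s)) (B (p, q)) q) (z : ℝ × ℝ) :
    HasFDerivAt F (A z • ContinuousLinearMap.fst ℝ ℝ ℝ + B z • ContinuousLinearMap.snd ℝ ℝ ℝ)
      z := by
  have key := hasStrictFDerivAt_uncurry_coprod (𝕜 := ℝ) (u := z) (f := fun p q => F (p, q))
    (f₁ := fun p q => ContinuousLinearMap.toSpanSingleton ℝ (A (p, q)))
    (f₂ := fun p q => ContinuousLinearMap.toSpanSingleton ℝ (B (p, q)))
    (Eventually.of_forall fun v => (hFA v.1 v.2).hasFDerivAt)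
    (Eventually.of_forall fun v => (hFB v.1 v.2).hasFDerivAt)
    (((ContinuousLinearMap.toSpanSingletonCLE (𝕜 := ℝ) (E := ℝ)).continuous.comp hA).continuousAt)
    (((ContinuousLinearMap.toSpanSingletonCLE (𝕜 := ℝ) (E := ℝ)).continuous.comp hB).continuousAt)
  refine key.hasFDerivAt.congr_fderiv ?_
  ext <;> simp [Function.HasUncurry.uncurry]

theorem contDiff_succ_of_partials {F A B : ℝ × ℝ → ℝ} {n : ℕ} (hA : ContDiff ℝ n A)
    (hB : ContDiff ℝ n B) (hFA : ∀ p q, HasDerivAt (fun r => F (r, q)) (A (p, q)) p)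
    (hFB : ∀ p q, HasDerivAt (fun s => F (p, s)) (B (p, q)) q) :
    ContDiff ℝ (n + 1 : ℕ) F := by
  refine contDiff_succ_iff_hasFDerivAt.2
    ⟨_, ?_, hasFDerivAt_of_partials hA.continuous hB.continuous hFA hFB⟩
  fun_prop

/-- Differentiation with respect to the parameter under the integral sign. -/
theorem hasDerivAt_primitive_param {h : ℝ × ℝ → ℝ} (hh : ContDiff ℝ 1 h) (p q : ℝ) :
    HasDerivAt (fun r => ∫ s in (0 : ℝ)..q, h (r, s))
      (∫ s in (0 : ℝ)..q, fderiv ℝ h (p, s) (1, 0)) p := by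
  have hc := hh.continuous
  have hd : Continuous fun z => fderiv ℝ h z (1, 0) :=
    (hh.continuous_fderiv one_ne_zero).clm_apply continuous_const
  obtain ⟨C, hC⟩ := ((isCompact_Icc (a := p - 1) (b := p + 1)).prod
    (isCompact_uIcc (a := 0) (b := q))).exists_bound_of_continuousOn hd.continuousOn
  refine (intervalIntegral.hasDerivAt_integral_of_dominated_loc_of_deriv_le (μ := volume)
    (bound := fun _ => C)
    (F' := fun r s => fderiv ℝ h (r, s) (1, 0))
    (Icc_mem_nhds (by linarith : p - 1 < p) (by linarith : p < p + 1)) ?_ ?_ ?_ ?_ ?_ ?_).2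
  · exact Eventually.of_forall fun r =>
      (by fun_prop : Continuous fun s => h (r, s)).aestronglyMeasurable
  · exact (by fun_prop : Continuous fun s => h (p, s)).intervalIntegrable _ _
  · exact (hd.comp (by fun_prop : Continuous fun s : ℝ => (p, s))).aestronglyMeasurable
  · exact Eventually.of_forall fun s hs r hr => hC (r, s) ⟨hr, uIoc_subset_uIcc hs⟩
  · exact intervalIntegrable_const
  · refine Eventually.of_forall fun s _ r _ => ?_
    have h1 := (hh.differentiable one_ne_zero (r, s)).hasFDerivAt
    exact h1.comp_hasDerivAt r ((hasDerivAt_id r).prodMk (hasDerivAt_const r s))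

theorem hasDerivAt_primitive {φ : ℝ → ℝ} (hφ : Continuous φ) (a q : ℝ) :
    HasDerivAt (fun s => ∫ r in a..s, φ r) (φ q) q :=
  (hφ.integral_hasStrictDerivAt a q).hasDerivAt

/-- Integration in one variable from `0` to that variable preserves `C^n` regularity in both. -/
theorem contDiff_primitive_snd {n : ℕ} : ∀ {h : ℝ × ℝ → ℝ}, ContDiff ℝ n h →
    ContDiff ℝ n (fun z : ℝ × ℝ => ∫ s in (0 : ℝ)..z.2, h (z.1, s)) := by
  induction n with
  | zero =>
    intro h hh
    have := hh.continuous
    refine contDiff_zero.2 ?_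
    exact continuous_parametric_intervalIntegral_of_continuous
      (f := fun (z : ℝ × ℝ) s => h (z.1, s)) (by fun_prop) continuous_snd
  | succ n ih =>
    intro h hh
    have h1 : ContDiff ℝ n fun z => fderiv ℝ h z (1, 0) :=
      (hh.fderiv_right (m := n) (by norm_cast)).clm_apply contDiff_const
    refine contDiff_succ_of_partials (ih h1) (hh.of_le (by norm_cast; omega)) (fun p q => ?_)
      (fun p q => ?_)
    · exact hasDerivAt_primitive_param (hh.of_le (by norm_cast; omega)) p q
    · exact hasDerivAt_primitive
        (hh.continuous.comp (by fun_prop : Continuous fun s : ℝ => (p, s))) 0 q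

theorem contDiff_integral_snd {n : ℕ} {h : ℝ × ℝ → ℝ} (hh : ContDiff ℝ n h) :
    ContDiff ℝ n (fun z : ℝ × ℝ => ∫ s in z.2..z.1, h (z.1, s)) := by
  have h1 := (contDiff_primitive_snd hh).comp
    (by fun_prop : ContDiff ℝ n fun z : ℝ × ℝ => (z.1, z.1))
  convert h1.sub (contDiff_primitive_snd hh) using 2 with z
  have hi : ∀ a b, IntervalIntegrable (fun s => h (z.1, s)) volume a b := fun a b =>
    (hh.continuous.comp (by fun_prop : Continuous fun s : ℝ => (z.1, s))).intervalIntegrable a b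
  exact (integral_interval_sub_left (hi _ _) (hi _ _)).symm

theorem contDiff_integral_fst {n : ℕ} {h : ℝ × ℝ → ℝ} (hh : ContDiff ℝ n h) :
    ContDiff ℝ n (fun z : ℝ × ℝ => ∫ r in z.1..z.2, h (r, z.2)) :=
  (contDiff_integral_snd (h := fun z => h (z.2, z.1)) (hh.comp (by fun_prop))).comp
    (by fun_prop : ContDiff ℝ n fun z : ℝ × ℝ => (z.2, z.1))

/-- The solution `w` of `∂ₚ∂_q w = -h` that vanishes to first order on the diagonal `p = q`. It is
the integral of `h` over the triangle with vertices `(p,q)`, `(p,p)`, `(q,q)`, written as a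
combination of integrals over triangles and rectangles with a vertex at the origin, so that partial
derivatives can be taken when `h` is merely continuous. -/
noncomputable def triInt (h : ℝ × ℝ → ℝ) (z : ℝ × ℝ) : ℝ :=
  (∫ r in (0 : ℝ)..z.1, ∫ s in (0 : ℝ)..r, h (r, s)) +
    (∫ s in (0 : ℝ)..z.2, ∫ r in (0 : ℝ)..s, h (r, s)) -
    ∫ r in (0 : ℝ)..z.1, ∫ s in (0 : ℝ)..z.2, h (r, s)

section TriInt

variable {h : ℝ × ℝ → ℝ}

theorem hasDerivAt_triInt_fst (hh : Continuous h) (p q : ℝ) :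
    HasDerivAt (fun r => triInt h (r, q)) (∫ s in q..p, h (p, s)) p := by
  have c1 : Continuous fun r => ∫ s in (0 : ℝ)..r, h (r, s) :=
    continuous_parametric_intervalIntegral_of_continuous
      (f := fun (r : ℝ) s => h (r, s)) (by fun_prop) continuous_id
  have c2 : Continuous fun r => ∫ s in (0 : ℝ)..q, h (r, s) :=
    continuous_parametric_intervalIntegral_of_continuous'
      (f := fun (r : ℝ) s => h (r, s)) (by fun_prop) 0 q
  have hi : ∀ a b, IntervalIntegrable (fun s => h (p, s)) volume a b := fun a b =>
    (hh.comp (by fun_prop : Continuous fun s : ℝ => (p, s))).intervalIntegrable a b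
  refine (((hasDerivAt_primitive c1 0 p).add_const
    (∫ s in (0 : ℝ)..q, ∫ r in (0 : ℝ)..s, h (r, s))).sub
    (hasDerivAt_primitive c2 0 p)).congr_deriv ?_
  exact integral_interval_sub_left (hi _ _) (hi _ _)

theorem hasDerivAt_triInt_snd (hh : Continuous h) (p q : ℝ) :
    HasDerivAt (fun s => triInt h (p, s)) (∫ r in p..q, h (r, q)) q := by
  have c1 : Continuous fun s => ∫ r in (0 : ℝ)..s, h (r, s) :=
    continuous_parametric_intervalIntegral_of_continuous
      (f := fun (s : ℝ) r => h (r, s)) (by fun_prop) continuous_id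
  have c2 : Continuous fun s => ∫ r in (0 : ℝ)..p, h (r, s) :=
    continuous_parametric_intervalIntegral_of_continuous'
      (f := fun (s : ℝ) r => h (r, s)) (by fun_prop) 0 p
  have hi : ∀ a b, IntervalIntegrable (fun r => h (r, q)) volume a b := fun a b =>
    (hh.comp (by fun_prop : Continuous fun r : ℝ => (r, q))).intervalIntegrable a b
  have heq : (fun s => triInt h (p, s)) = fun q =>
      (∫ r in (0 : ℝ)..p, ∫ s in (0 : ℝ)..r, h (r, s)) +
        (∫ s in (0 : ℝ)..q, ∫ r in (0 : ℝ)..s, h (r, s)) -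
        ∫ s in (0 : ℝ)..q, ∫ r in (0 : ℝ)..p, h (r, s) := by
    funext q
    simp only [triInt]
    rw [intervalIntegral_intervalIntegral_swap (F := fun r s => h (r, s))]
    exact (hh.continuousOn.integrableOn_compact (isCompact_uIcc.prod isCompact_uIcc)).mono_set
      (prod_mono uIoc_subset_uIcc uIoc_subset_uIcc)
  rw [heq]
  refine (((hasDerivAt_primitive c1 0 q).const_add _).sub
    (hasDerivAt_primitive c2 0 q)).congr_deriv ?_
  exact integral_interval_sub_left (hi _ _) (hi _ _)

theorem contDiff_triInt {n : ℕ} (hh : ContDiff ℝ n h) : ContDiff ℝ (n + 1 : ℕ) (triInt h) :=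
  contDiff_succ_of_partials (contDiff_integral_snd hh) (contDiff_integral_fst hh)
    (hasDerivAt_triInt_fst hh.continuous) (hasDerivAt_triInt_snd hh.continuous)

theorem hasFDerivAt_triInt (hh : Continuous h) (z : ℝ × ℝ) :
    HasFDerivAt (triInt h) ((∫ s in z.2..z.1, h (z.1, s)) • ContinuousLinearMap.fst ℝ ℝ ℝ +
      (∫ r in z.1..z.2, h (r, z.2)) • ContinuousLinearMap.snd ℝ ℝ ℝ) z :=
  hasFDerivAt_of_partials (contDiff_integral_snd (contDiff_zero.2 hh)).continuous
    (contDiff_integral_fst (contDiff_zero.2 hh)).continuous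
    (hasDerivAt_triInt_fst hh) (hasDerivAt_triInt_snd hh) z

/-- The boundary values on the diagonal follow from the partial derivatives, which cancel there. -/
theorem triInt_diag (hh : Continuous h) (x : ℝ) : triInt h (x, x) = 0 := by
  have hd : ∀ x, HasDerivAt (fun x => triInt h (x, x)) 0 x := fun x => by
    have := (hasFDerivAt_triInt hh (x, x)).comp_hasDerivAt (f := fun x : ℝ => (x, x)) x
      ((hasDerivAt_id x).prodMk (hasDerivAt_id x))
    exact this.congr_deriv (by simp)
  have := is_const_of_deriv_eq_zero (fun x => (hd x).differentiableAt) (fun x => (hd x).deriv) x 0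
  simpa [triInt] using this

theorem abs_triInt_sub_le {k : ℝ × ℝ → ℝ} (hh : Continuous h) (hk : Continuous k) {D : ℝ}
    (hD : ∀ z, |h z - k z| ≤ D) (z : ℝ × ℝ) :
    |triInt h z - triInt k z| ≤ D * (z.1 - z.2) ^ 2 := by
  obtain ⟨p, q⟩ := z
  have hD0 : 0 ≤ D := (abs_nonneg _).trans (hD (0, 0))
  have key := Convex.norm_image_sub_le_of_norm_hasDerivWithin_le
    (f := fun r => triInt h (r, q) - triInt k (r, q))
    (f' := fun r => (∫ s in q..r, h (r, s)) - ∫ s in q..r, k (r, s)) (s := uIcc q p)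
    (C := D * |p - q|) (x := q) (y := p)
    (fun r _ =>
      ((hasDerivAt_triInt_fst hh r q).sub (hasDerivAt_triInt_fst hk r q)).hasDerivWithinAt)
    (fun r hr => ?_) (convex_uIcc q p) left_mem_uIcc right_mem_uIcc
  · simpa [triInt_diag hh, triInt_diag hk, mul_assoc, abs_mul_abs_self, ← pow_two] using key
  · have hi : ∀ {φ : ℝ × ℝ → ℝ}, Continuous φ → IntervalIntegrable (fun s => φ (r, s)) volume q r :=
      fun hφ => (hφ.comp (by fun_prop : Continuous fun s : ℝ => (r, s))).intervalIntegrable _ _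
    rw [← integral_sub (hi hh) (hi hk)]
    refine (norm_integral_le_of_norm_le_const (C := D) fun s _ => hD (r, s)).trans ?_
    have : |r - q| ≤ |p - q| := abs_sub_left_of_mem_uIcc hr
    gcongr

theorem abs_triInt_le (hh : Continuous h) {D : ℝ} (hD : ∀ z, |h z| ≤ D) (z : ℝ × ℝ) :
    |triInt h z| ≤ D * (z.1 - z.2) ^ 2 := by
  have := abs_triInt_sub_le hh (continuous_const (y := (0 : ℝ))) (by simpa using hD) z
  simpa [triInt] using this

end TriInt

/-! ### Smooth solutions of the semilinear wave equation with a small coefficient -/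

/-- The integral equation `w = χ · triInt (g (v + c w))` has a bounded continuous solution: the
cutoff `χ` in `p - q`, that is, in time, makes the right-hand side a contraction of the bounded
continuous functions on the whole plane when `c` is small. -/
theorem exists_fixedPoint_triInt {g : ℝ → ℝ} {v : ℝ × ℝ → ℝ} (hg : Continuous g)
    (hv : Continuous v) {G L R c : ℝ} (hG : ∀ y, |g y| ≤ G)
    (hL : ∀ y z, |g y - g z| ≤ L * |y - z|) (hR : 0 < R) (hc : 0 ≤ c)
    (hsmall : c * L * (R + 1) ^ 2 ≤ 1 / 2) (χ : ContDiffBump (0 : ℝ)) (hχ : χ.rOut = R + 1) :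
    ∃ w : ℝ × ℝ → ℝ, Continuous w ∧
      ∀ z, w z = χ (z.1 - z.2) * triInt (fun z => g (v z + c * w z)) z := by
  have hcut : ∀ (d y D : ℝ), 0 ≤ D → |y| ≤ D * d ^ 2 → |χ d * y| ≤ D * (R + 1) ^ 2 := by
    intro d y D hD hy
    rcases le_or_gt (R + 1) |d| with h | h
    · rw [χ.zero_of_le_dist (by simpa [hχ] using h), zero_mul, abs_zero]
      positivity
    · rw [abs_mul, abs_of_nonneg χ.nonneg]
      have h1 : d ^ 2 ≤ (R + 1) ^ 2 :=
        sq_le_sq' (by linarith [neg_abs_le d]) (by linarith [le_abs_self d])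
      calc χ d * |y| ≤ 1 * (D * (R + 1) ^ 2) := by
            gcongr
            · exact χ.le_one
            · exact hy.trans (by gcongr)
        _ = _ := one_mul _
  have hG0 : 0 ≤ G := (abs_nonneg _).trans (hG 0)
  have hL0 : 0 ≤ L := by simpa using (abs_nonneg _).trans (hL 1 0)
  have hcont : ∀ w : BoundedContinuousFunction (ℝ × ℝ) ℝ,
      Continuous fun z => g (v z + c * w z) := fun w =>
    hg.comp (hv.add (continuous_const.mul w.continuous))
  have htri : ∀ {h : ℝ × ℝ → ℝ}, Continuous h → Continuous (triInt h) := fun hh =>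
    (contDiff_triInt (n := 0) (contDiff_zero.2 hh)).continuous
  let N : BoundedContinuousFunction (ℝ × ℝ) ℝ → BoundedContinuousFunction (ℝ × ℝ) ℝ := fun w =>
    BoundedContinuousFunction.ofNormedAddCommGroup
      (fun z => χ (z.1 - z.2) * triInt (fun z => g (v z + c * w z)) z)
      ((χ.continuous.comp (by fun_prop)).mul (htri (hcont w))) (G * (R + 1) ^ 2)
      fun z => hcut _ _ _ hG0 (abs_triInt_le (hcont w) (fun z => hG _) z)
  have hN : ContractingWith (1 / 2) N := by
    refine ⟨by rw [← NNReal.coe_lt_coe]; norm_num, LipschitzWith.of_dist_le_mul fun w₁ w₂ => ?_⟩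
    rw [BoundedContinuousFunction.dist_le (by positivity)]
    intro z
    have h1 : ∀ z, |g (v z + c * w₁ z) - g (v z + c * w₂ z)| ≤ L * c * dist w₁ w₂ := by
      intro z
      refine (hL _ _).trans ?_
      rw [add_sub_add_left_eq_sub, ← mul_sub, abs_mul, abs_of_nonneg hc, ← mul_assoc]
      gcongr
      exact BoundedContinuousFunction.dist_coe_le_dist (f := w₁) (g := w₂) z
    have h2 := hcut (z.1 - z.2) _ _ (by positivity)
      (abs_triInt_sub_le (hcont w₁) (hcont w₂) h1 z)
    have h3 : dist (N w₁ z) (N w₂ z) = |χ (z.1 - z.2) * (triInt (fun z => g (v z + c * w₁ z)) z -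
        triInt (fun z => g (v z + c * w₂ z)) z)| := by
      rw [Real.dist_eq, mul_sub]; rfl
    rw [h3]
    refine h2.trans ?_
    have := mul_le_mul_of_nonneg_right hsmall (dist_nonneg (x := w₁) (y := w₂))
    simp only [NNReal.coe_div, NNReal.coe_one, NNReal.coe_ofNat]
    linarith
  obtain ⟨w, hw⟩ : ∃ w, Function.IsFixedPt N w := ⟨_, hN.fixedPoint_isFixedPt⟩
  exact ⟨w, w.continuous, fun z =>
    (congrArg (fun w : BoundedContinuousFunction (ℝ × ℝ) ℝ => w z) hw).symm⟩

/-- Solution of `∂ₚ∂_q u = -c g(u)` near the diagonal `p = q`, with the Cauchy data of `a(p) + b(q)`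
on it. Where the cutoff is `1`, the fixed point of `exists_fixedPoint_triInt` satisfies
`u = a + b + c w`; the function `u` itself is `a + b + c triInt (g (a + b + c w))`, which is smooth
on the whole plane. -/
theorem exists_characteristic_solution {g a b : ℝ → ℝ} (hg : ContDiff ℝ ∞ g)
    (ha : ContDiff ℝ ∞ a) (hb : ContDiff ℝ ∞ b) {G L R c : ℝ} (hG : ∀ y, |g y| ≤ G)
    (hL : ∀ y z, |g y - g z| ≤ L * |y - z|) (hR : 0 < R) (hc : 0 ≤ c)
    (hsmall : c * L * (R + 1) ^ 2 ≤ 1 / 2) :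
    ∃ u : ℝ × ℝ → ℝ, ContDiff ℝ ∞ u ∧
      (∀ z, |u z - (a z.1 + b z.2)| ≤ c * G * (z.1 - z.2) ^ 2) ∧
      (∀ x, u (x, x) = a x + b x) ∧
      (∀ x, fderiv ℝ u (x, x) = deriv a x • ContinuousLinearMap.fst ℝ ℝ ℝ +
        deriv b x • ContinuousLinearMap.snd ℝ ℝ ℝ) ∧
      ∀ z : ℝ × ℝ, |z.1 - z.2| < R →
        fderiv ℝ (fun z => fderiv ℝ u z (0, 1)) z (1, 0) = -(c * g (u z)) := by
  let χ : ContDiffBump (0 : ℝ) := ⟨R, R + 1, hR, by linarith⟩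
  obtain ⟨w, hwc, hw⟩ := exists_fixedPoint_triInt (v := fun z => a z.1 + b z.2) hg.continuous
    (by have := ha.continuous; have := hb.continuous; fun_prop) hG hL hR hc hsmall χ rfl
  set h : ℝ × ℝ → ℝ := fun z => g (a z.1 + b z.2 + c * w z) with hh
  have hv : ContDiff ℝ ∞ fun z : ℝ × ℝ => a z.1 + b z.2 :=
    (ha.comp contDiff_fst).add (hb.comp contDiff_snd)
  have hcast : ∀ n : ℕ, ((n : ℕ) : WithTop ℕ∞) ≤ ∞ := fun n => by exact_mod_cast le_top
  have hh_of : ∀ n : ℕ, ContDiff ℝ n w → ContDiff ℝ n h := fun n hn =>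
    (hg.of_le (hcast n)).comp ((hv.of_le (hcast n)).add (contDiff_const.mul hn))
  -- each integration gains one derivative
  have hwn : ∀ n : ℕ, ContDiff ℝ n w := by
    intro n
    induction n with
    | zero => exact contDiff_zero.2 hwc
    | succ n ih =>
      have h1 : w = fun z => χ (z.1 - z.2) * triInt h z := funext hw
      rw [h1]
      exact ((χ.contDiff (n := ((n + 1 : ℕ) : ℕ∞))).comp
        (contDiff_fst.sub contDiff_snd)).mul (contDiff_triInt (hh_of n ih))
  have hhs : ContDiff ℝ ∞ h := contDiff_infty.2 fun n => hh_of n (hwn n)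
  have hts : ContDiff ℝ ∞ (triInt h) := contDiff_infty.2 fun n =>
    (contDiff_triInt (hh_of n (hwn n))).of_le (by norm_cast; omega)
  have hhc := hhs.continuous
  have hfd : ∀ z, HasFDerivAt (fun z => a z.1 + b z.2 + c * triInt h z)
      ((deriv a z.1 + c * ∫ s in z.2..z.1, h (z.1, s)) • ContinuousLinearMap.fst ℝ ℝ ℝ +
        (deriv b z.2 + c * ∫ r in z.1..z.2, h (r, z.2)) • ContinuousLinearMap.snd ℝ ℝ ℝ) z := by
    intro z
    have h1 := ((ha.differentiable (by simp) z.1).hasDerivAt.comp_hasFDerivAt z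
      (hasFDerivAt_fst (𝕜 := ℝ) (p := z)))
    have h2 := ((hb.differentiable (by simp) z.2).hasDerivAt.comp_hasFDerivAt z
      (hasFDerivAt_snd (𝕜 := ℝ) (p := z)))
    refine ((h1.add h2).add ((hasFDerivAt_triInt hhc z).const_mul c)).congr_fderiv ?_
    ext <;> simp
  refine ⟨fun z => a z.1 + b z.2 + c * triInt h z, hv.add (contDiff_const.mul hts), fun z => ?_,
    fun x => ?_, fun x => ?_, fun z hz => ?_⟩
  · rw [add_sub_cancel_left, abs_mul, abs_of_nonneg hc, mul_assoc]
    gcongr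
    exact abs_triInt_le hhc (fun z => hG _) z
  · simp [triInt_diag hhc]
  · rw [(hfd (x, x)).fderiv]
    simp
  · have h1 : (fun z => fderiv ℝ (fun z => a z.1 + b z.2 + c * triInt h z) z (0, 1)) =
        fun z => deriv b z.2 + c * ∫ r in z.1..z.2, h (r, z.2) := by
      funext z
      rw [(hfd z).fderiv]
      simp
    have hb' : ContDiff ℝ ∞ (deriv b) := (contDiff_infty_iff_deriv.1 hb).2
    have h2 : ContDiff ℝ ∞ fun z : ℝ × ℝ => deriv b z.2 + c * ∫ r in z.1..z.2, h (r, z.2) :=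
      (hb'.comp contDiff_snd).add (contDiff_const.mul
        (contDiff_infty.2 fun n => contDiff_integral_fst (hh_of n (hwn n))))
    have h3 := (h2.differentiable (by simp) z).hasFDerivAt.comp_hasDerivAt
      (f := fun r : ℝ => (r, z.2)) z.1
      ((hasDerivAt_id z.1).prodMk (hasDerivAt_const z.1 z.2))
    have h4 : HasDerivAt (fun r : ℝ => deriv b z.2 + c * ∫ r in r..z.2, h (r, z.2))
        (c * -h z) z.1 := by
      refine HasDerivAt.const_add _ (HasDerivAt.const_mul c ?_)
      exact integral_hasDerivAt_left
        ((hhc.comp (by fun_prop : Continuous fun r : ℝ => (r, z.2))).intervalIntegrable _ _)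
        ((hhc.comp (by fun_prop : Continuous fun r : ℝ => (r, z.2))).stronglyMeasurableAtFilter _ _)
        (hhc.comp (by fun_prop : Continuous fun r : ℝ => (r, z.2))).continuousAt
    rw [h1, h3.unique h4]
    -- the cutoff equals `1` at `z`, so that the argument of `g` in `h` is `u`
    have h5 : w z = triInt h z := by
      rw [hw z, χ.one_of_mem_closedBall (by simpa [χ] using hz.le), one_mul]
    simp only [hh, h5]
    ring

/-- The derivative of `F` in direction `v`. -/
noncomputable def dirD {E : Type*} [NormedAddCommGroup E] [NormedSpace ℝ E] (v : E) (F : E → ℝ) :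
    E → ℝ := fun z => fderiv ℝ F z v

/-- The solution of `∂ₜ²v = ∂ₓ²v` with `v = u₀` and `∂ₜv = u₁` at `t = 0`. -/
noncomputable def dAlembert (u₀ u₁ : ℝ → ℝ) (z : ℝ × ℝ) : ℝ :=
  (u₀ (z.2 + z.1) + u₀ (z.2 - z.1)) / 2 + (∫ y in (z.2 - z.1)..(z.2 + z.1), u₁ y) / 2

/-- Solution of the Cauchy problem `∂ₜ²u - ∂ₓ²u = λ g(u)` on `|t| < T` for small `λ`, in the
characteristic coordinates `p = x + t`, `q = x - t`. The wave operator appears as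
`-(∂ₓ + ∂ₜ)(∂ₓ - ∂ₜ)`. -/
theorem exists_wave_solution {g u₀ u₁ : ℝ → ℝ} (hg : ContDiff ℝ ∞ g) (h₀ : ContDiff ℝ ∞ u₀)
    (h₁ : ContDiff ℝ ∞ u₁) {G L T lam : ℝ} (hG : ∀ y, |g y| ≤ G)
    (hL : ∀ y z, |g y - g z| ≤ L * |y - z|) (hT : 0 < T) (hlam : 0 ≤ lam)
    (hsmall : lam * L * (2 * T + 1) ^ 2 ≤ 2) :
    ∃ u : ℝ × ℝ → ℝ, ContDiff ℝ ∞ u ∧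
      (∀ z, |u z - dAlembert u₀ u₁ z| ≤ lam * G * z.1 ^ 2) ∧
      (∀ x, u (0, x) = u₀ x) ∧ (∀ x, dirD (1, 0) u (0, x) = u₁ x) ∧
      ∀ z : ℝ × ℝ, |z.1| < T → dirD (1, 1) (dirD (-1, 1) u) z = -(lam * g (u z)) := by
  set I : ℝ → ℝ := fun x => ∫ y in (0 : ℝ)..x, u₁ y with hI
  have hId : ∀ x, HasDerivAt I (u₁ x) x := hasDerivAt_primitive h₁.continuous 0
  have hIs : ContDiff ℝ ∞ I := contDiff_infty_iff_deriv.2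
    ⟨fun x => (hId x).differentiableAt, by rwa [funext fun x => (hId x).deriv]⟩
  have hd₀ : ∀ x, HasDerivAt u₀ (deriv u₀ x) x := fun x =>
    (h₀.differentiable (by simp) x).hasDerivAt
  obtain ⟨U, hU, hbd, hdiag, hdiag', heq⟩ := exists_characteristic_solution
    (a := fun x => (u₀ x + I x) / 2) (b := fun x => (u₀ x - I x) / 2) (R := 2 * T)
    (c := lam / 4) hg ((h₀.add hIs).div_const 2) ((h₀.sub hIs).div_const 2) hG hL (by positivity)
    (by positivity) (by linarith)
  let ℓ : ℝ × ℝ →L[ℝ] ℝ × ℝ :=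
    (ContinuousLinearMap.snd ℝ ℝ ℝ + ContinuousLinearMap.fst ℝ ℝ ℝ).prod
      (ContinuousLinearMap.snd ℝ ℝ ℝ - ContinuousLinearMap.fst ℝ ℝ ℝ)
  have hℓ : ∀ z, ℓ z = (z.2 + z.1, z.2 - z.1) := fun z => rfl
  have hdir : ∀ F : ℝ × ℝ → ℝ, ContDiff ℝ ∞ F → ∀ v z,
      dirD v (fun z => F (ℓ z)) z = fderiv ℝ F (ℓ z) (ℓ v) := by
    intro F hF v z
    have := ((hF.differentiable (by simp) (ℓ z)).hasFDerivAt.comp z ℓ.hasFDerivAt).fderiv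
    exact congrArg (fun A : ℝ × ℝ →L[ℝ] ℝ => A v) this
  refine ⟨fun z => U (ℓ z), hU.comp ℓ.contDiff, fun z => ?_, fun x => ?_, fun x => ?_,
    fun z hz => ?_⟩
  · have hi : ∀ a b, IntervalIntegrable u₁ volume a b := fun a b =>
      h₁.continuous.intervalIntegrable a b
    have h2 : dAlembert u₀ u₁ z =
        (u₀ (ℓ z).1 + I (ℓ z).1) / 2 + (u₀ (ℓ z).2 - I (ℓ z).2) / 2 := by
      simp only [dAlembert, hℓ, hI]
      rw [← integral_interval_sub_left (hi 0 _) (hi 0 _)]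
      ring
    rw [h2]
    refine (hbd (ℓ z)).trans_eq ?_
    rw [hℓ]
    ring
  · simp only [hℓ, add_zero, sub_zero, hdiag]
    ring
  · rw [hdir U hU, hℓ, hℓ]
    simp only [add_zero, sub_zero, hdiag']
    have e₁ : deriv (fun x => (u₀ x + I x) / 2) x = (deriv u₀ x + u₁ x) / 2 :=
      (((hd₀ x).add (hId x)).div_const 2).deriv
    have e₂ : deriv (fun x => (u₀ x - I x) / 2) x = (deriv u₀ x - u₁ x) / 2 :=
      (((hd₀ x).sub (hId x)).div_const 2).deriv
    rw [e₁, e₂]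
    simp
    ring
  · have hU' : ContDiff ℝ ∞ fun z => fderiv ℝ U z (0, 1) :=
      (contDiff_infty_iff_fderiv.1 hU).2.clm_apply contDiff_const
    have e1 : ℓ (-1, 1) = (2 : ℝ) • ((0 : ℝ), (1 : ℝ)) := by
      rw [hℓ]; ext <;> norm_num
    have e2 : ℓ (1, 1) = (2 : ℝ) • ((1 : ℝ), (0 : ℝ)) := by
      rw [hℓ]; ext <;> norm_num
    have h3 : dirD (-1, 1) (fun z => U (ℓ z)) =
        fun z => (fun z => 2 * fderiv ℝ U z (0, 1)) (ℓ z) := by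
      funext z
      rw [hdir U hU, e1, map_smul, smul_eq_mul]
    have h4 : fderiv ℝ (fun z => 2 * fderiv ℝ U z (0, 1)) (ℓ z) =
        (2 : ℝ) • fderiv ℝ (fun z => fderiv ℝ U z (0, 1)) (ℓ z) :=
      fderiv_const_mul (hU'.differentiable (by simp) _) 2
    rw [h3, hdir _ (contDiff_const.mul hU'), e2, map_smul, h4]
    have h5 := heq (ℓ z) (by
      rw [hℓ, show z.2 + z.1 - (z.2 - z.1) = 2 * z.1 by ring, abs_mul, abs_two]; linarith)
    simp only [smul_apply, h5, smul_eq_mul]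
    ring

end Colombeau

namespace Colombeau

/-! ### Directional derivatives -/

section DirD

variable {E : Type*} [NormedAddCommGroup E] [NormedSpace ℝ E] {F G : E → ℝ}

theorem contDiff_dirD (hF : ContDiff ℝ ∞ F) (v : E) : ContDiff ℝ ∞ (dirD v F) :=
  (contDiff_infty_iff_fderiv.1 hF).2.clm_apply contDiff_const

theorem contDiff_dirD_iterate (hF : ContDiff ℝ ∞ F) (v : E) (a : ℕ) :
    ContDiff ℝ ∞ ((dirD v)^[a] F) := by
  induction a with
  | zero => exact hF
  | succ a ih => rw [Function.iterate_succ_apply']; exact contDiff_dirD ih v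

theorem dirD_add (hF : ContDiff ℝ ∞ F) (hG : ContDiff ℝ ∞ G) (v : E) :
    dirD v (fun z => F z + G z) = fun z => dirD v F z + dirD v G z := by
  funext z
  simp only [dirD]
  rw [fderiv_fun_add (hF.differentiable (by simp) z) (hG.differentiable (by simp) z)]
  rfl

theorem dirD_mul (hF : ContDiff ℝ ∞ F) (hG : ContDiff ℝ ∞ G) (v : E) :
    dirD v (fun z => F z * G z) = fun z => F z * dirD v G z + G z * dirD v F z := by
  funext z
  simp only [dirD]
  rw [fderiv_fun_mul (hF.differentiable (by simp) z) (hG.differentiable (by simp) z)]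
  rfl

theorem dirD_const (r : ℝ) (v : E) : dirD v (fun _ => r) = fun _ => 0 := by
  funext z
  simp [dirD]

theorem dirD_comp {g : ℝ → ℝ} (hg : ContDiff ℝ ∞ g) (hF : ContDiff ℝ ∞ F) (v : E) :
    dirD v (fun z => g (F z)) = fun z => deriv g (F z) * dirD v F z := by
  funext z
  have := ((hg.differentiable (by simp) (F z)).hasDerivAt.comp_hasFDerivAt z
    (hF.differentiable (by simp) z).hasFDerivAt).fderiv
  exact congrArg (fun A : E →L[ℝ] ℝ => A v) this

theorem dirD_comm (hF : ContDiff ℝ ∞ F) (v w : E) :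
    dirD v (dirD w F) = dirD w (dirD v F) := by
  funext z
  have hd : DifferentiableAt ℝ (fderiv ℝ F) z :=
    (contDiff_infty_iff_fderiv.1 hF).2.differentiable (by simp) z
  have h : ∀ v w, dirD v (dirD w F) z = fderiv ℝ (fderiv ℝ F) z v w := by
    intro v w
    have h1 : HasFDerivAt (fun z => fderiv ℝ F z w)
        ((ContinuousLinearMap.apply ℝ ℝ w).comp (fderiv ℝ (fderiv ℝ F) z)) z :=
      (ContinuousLinearMap.apply ℝ ℝ w).hasFDerivAt.comp z hd.hasFDerivAt
    change fderiv ℝ (fun z => fderiv ℝ F z w) z v = _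
    rw [h1.fderiv]
    rfl
  rw [h, h]
  exact ((contDiff_infty.1 hF 2).contDiffAt.isSymmSndFDerivAt (by simp)).eq v w

theorem dirD_iterate_comm (hF : ContDiff ℝ ∞ F) (v w : E) (a : ℕ) :
    dirD v ((dirD w)^[a] F) = (dirD w)^[a] (dirD v F) := by
  induction a with
  | zero => rfl
  | succ a ih =>
    rw [Function.iterate_succ_apply', Function.iterate_succ_apply', ← ih,
      dirD_comm (contDiff_dirD_iterate hF w a)]

theorem dirD_iterate_iterate_comm (hF : ContDiff ℝ ∞ F) (v w : E) (a b : ℕ) :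
    (dirD v)^[b] ((dirD w)^[a] F) = (dirD w)^[a] ((dirD v)^[b] F) := by
  induction b with
  | zero => rfl
  | succ b ih =>
    rw [Function.iterate_succ_apply', Function.iterate_succ_apply', ih,
      dirD_iterate_comm (contDiff_dirD_iterate hF v b)]

theorem dirD_eqOn {O : Set E} (hO : IsOpen O) (h : EqOn F G O) (v : E) :
    EqOn (dirD v F) (dirD v G) O := fun z hz => by
  have : F =ᶠ[𝓝 z] G := h.eventuallyEq_of_mem (hO.mem_nhds hz)
  simp only [dirD]
  rw [this.fderiv_eq]

theorem dirD_iterate_eqOn {O : Set E} (hO : IsOpen O) (h : EqOn F G O) (v : E) (a : ℕ) :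
    EqOn ((dirD v)^[a] F) ((dirD v)^[a] G) O := by
  induction a with
  | zero => exact h
  | succ a ih =>
    rw [Function.iterate_succ_apply', Function.iterate_succ_apply']
    exact dirD_eqOn hO ih v

theorem dirD_comb (v w : E) (α β : ℝ) :
    dirD (α • v + β • w) F = fun z => α * dirD v F z + β * dirD w F z := by
  funext z
  simp [dirD]

theorem dirD_iterate_comb (hF : ContDiff ℝ ∞ F) (hG : ContDiff ℝ ∞ G) (v : E) (c : ℝ) (a : ℕ) :
    (dirD v)^[a] (fun z => F z + c * G z) =
      fun z => (dirD v)^[a] F z + c * (dirD v)^[a] G z := by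
  induction a with
  | zero => rfl
  | succ a ih =>
    have h1 := contDiff_dirD_iterate hG v a
    rw [Function.iterate_succ_apply', ih, dirD_add (contDiff_dirD_iterate hF v a)
      (contDiff_const.mul h1), dirD_mul contDiff_const h1, dirD_const]
    simp only [Function.iterate_succ_apply', mul_zero, add_zero]

end DirD

/-! ### Tame nets and tame jets -/

/-- `sup_K |φ ε| = O(ε ^ (-m n))` for some `n : ℕ`. For `m = 0` this says that the net is of
bounded type on `K`, for `m = 1` that it is moderate on `K`; in both cases the nets with this
property form an algebra, so both kinds of estimates have a common proof. -/
def TameOn {X : Type*} (m : ℕ) (K : Set X) (φ : Eps → X → ℝ) : Prop :=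
  ∃ n : ℕ, UnifBigO K φ (-((m : ℝ) * n))

section Tame

variable {X : Type*} {m : ℕ} {K : Set X} {φ ψ : Eps → X → ℝ}

theorem tameOn_of_bounded {C : ℝ} (h : ∀ᶠ ε in toZero, ∀ x ∈ K, |φ ε x| ≤ C) : TameOn m K φ :=
  ⟨0, C, h.mono fun ε hε x hx => by simpa using hε x hx⟩

theorem tameOn_const (r : ℝ) : TameOn m K (fun _ _ => r) :=
  tameOn_of_bounded (C := |r|) (Eventually.of_forall fun _ _ _ => le_rfl)

theorem tameOn_zero_iff : TameOn 0 K φ ↔ ∃ C : ℝ, ∀ᶠ ε in toZero, ∀ x ∈ K, |φ ε x| ≤ C := by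
  simp [TameOn, UnifBigO]

theorem tameOn_one_iff : TameOn 1 K φ ↔ ModOn K φ := by
  refine ⟨fun ⟨n, hn⟩ => ⟨_, hn⟩, fun ⟨b, hb⟩ => ?_⟩
  obtain ⟨n, hn⟩ := exists_nat_ge (-b)
  exact ⟨n, hb.mono_exp (by push_cast; linarith)⟩

theorem tameOn_rate (C : ℝ) (n : ℕ) :
    TameOn m K (fun ε _ => C * (ε : ℝ) ^ (-((m : ℝ) * n))) :=
  ⟨n, |C|, Eventually.of_forall fun ε _ _ => by
    rw [abs_mul, abs_of_nonneg (Real.rpow_nonneg ε.2.1.le _)]⟩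

theorem TameOn.of_eventually_le (h : TameOn m K ψ)
    (hle : ∀ᶠ ε in toZero, ∀ x ∈ K, |φ ε x| ≤ |ψ ε x|) : TameOn m K φ := by
  obtain ⟨n, C, hC⟩ := h
  exact ⟨n, C, (hC.and hle).mono fun ε hε x hx => (hε.2 x hx).trans (hε.1 x hx)⟩

theorem TameOn.of_le (h : TameOn m K ψ) (hle : ∀ ε, ∀ x ∈ K, |φ ε x| ≤ |ψ ε x|) : TameOn m K φ :=
  h.imp fun _ hn => hn.of_le hle

theorem TameOn.congr (h : TameOn m K ψ) (heq : ∀ ε, ∀ x ∈ K, φ ε x = ψ ε x) : TameOn m K φ :=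
  h.of_le fun ε x hx => (congrArg abs (heq ε x hx)).le

theorem TameOn.mono {K' : Set X} (h : TameOn m K φ) (hK : K' ⊆ K) : TameOn m K' φ := by
  obtain ⟨n, C, hC⟩ := h
  exact ⟨n, C, hC.mono fun ε hε x hx => hε x (hK hx)⟩

theorem TameOn.add (h : TameOn m K φ) (h' : TameOn m K ψ) :
    TameOn m K (fun ε x => φ ε x + ψ ε x) := by
  obtain ⟨n, hn⟩ := h
  obtain ⟨k, hk⟩ := h'
  refine ⟨n + k, (hn.mono_exp ?_).add (hk.mono_exp ?_)⟩ <;> push_cast <;>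
    nlinarith [mul_nonneg (Nat.cast_nonneg (α := ℝ) m) (Nat.cast_nonneg (α := ℝ) n),
      mul_nonneg (Nat.cast_nonneg (α := ℝ) m) (Nat.cast_nonneg (α := ℝ) k)]

theorem TameOn.mul (h : TameOn m K φ) (h' : TameOn m K ψ) :
    TameOn m K (fun ε x => φ ε x * ψ ε x) := by
  obtain ⟨n, hn⟩ := h
  obtain ⟨k, hk⟩ := h'
  refine ⟨n + k, (hn.mul hk).mono_exp (le_of_eq ?_)⟩
  push_cast
  ring

end Tame

section Jet

variable {E : Type*} [NormedAddCommGroup E] [NormedSpace ℝ E]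

/-- The derivatives of order at most `n` along the directions `v`, `w` are tame on `K`. Taking
`v = w` gives the derivatives along a single direction. -/
def JetTame (m : ℕ) (v w : E) (K : Set E) : ℕ → (Eps → E → ℝ) → Prop
  | 0, u => TameOn m K u
  | n + 1, u => TameOn m K u ∧ JetTame m v w K n (fun ε => dirD v (u ε)) ∧
      JetTame m v w K n (fun ε => dirD w (u ε))

variable {m : ℕ} {v w : E} {K : Set E} {n : ℕ} {u u' : Eps → E → ℝ}

theorem JetTame.of_succ : ∀ {n : ℕ} {u : Eps → E → ℝ}, JetTame m v w K (n + 1) u →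
    JetTame m v w K n u := by
  intro n
  induction n with
  | zero => exact fun h => h.1
  | succ n ih => exact fun h => ⟨h.1, ih h.2.1, ih h.2.2⟩

theorem JetTame.of_le {k : ℕ} (h : JetTame m v w K n u) (hk : k ≤ n) : JetTame m v w K k u := by
  induction n, hk using Nat.le_induction with
  | base => exact h
  | succ n _ ih => exact ih h.of_succ

theorem jetTame_const (r : ℝ) : ∀ n : ℕ, JetTame m v w K n (fun _ _ => r) := by
  intro n
  induction n generalizing r with
  | zero => exact tameOn_const r
  | succ n ih =>
    refine ⟨tameOn_const r, ?_, ?_⟩ <;> simp only [dirD_const] <;> exact ih 0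

theorem jetTame_scalar {r : Eps → ℝ} (hr : ∀ ε, |r ε| ≤ 1) (n : ℕ) :
    JetTame m v w K n (fun ε _ => r ε) := by
  have h0 : TameOn m K (fun ε _ => r ε) :=
    tameOn_of_bounded (C := 1) (Eventually.of_forall fun ε _ _ => hr ε)
  cases n with
  | zero => exact h0
  | succ n => refine ⟨h0, ?_, ?_⟩ <;> simp only [dirD_const] <;> exact jetTame_const 0 n

theorem JetTame.add : ∀ {n : ℕ} {u u' : Eps → E → ℝ}, (∀ ε, ContDiff ℝ ∞ (u ε)) →
    (∀ ε, ContDiff ℝ ∞ (u' ε)) → JetTame m v w K n u → JetTame m v w K n u' →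
    JetTame m v w K n (fun ε z => u ε z + u' ε z) := by
  intro n
  induction n with
  | zero => exact fun _ _ h h' => TameOn.add h h'
  | succ n ih =>
    intro u u' hu hu' h h'
    refine ⟨h.1.add h'.1, ?_, ?_⟩ <;> simp only [dirD_add (hu _) (hu' _)]
    · exact ih (fun ε => contDiff_dirD (hu ε) v) (fun ε => contDiff_dirD (hu' ε) v) h.2.1 h'.2.1
    · exact ih (fun ε => contDiff_dirD (hu ε) w) (fun ε => contDiff_dirD (hu' ε) w) h.2.2 h'.2.2

theorem JetTame.mul : ∀ {n : ℕ} {u u' : Eps → E → ℝ}, (∀ ε, ContDiff ℝ ∞ (u ε)) →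
    (∀ ε, ContDiff ℝ ∞ (u' ε)) → JetTame m v w K n u → JetTame m v w K n u' →
    JetTame m v w K n (fun ε z => u ε z * u' ε z) := by
  intro n
  induction n with
  | zero => exact fun _ _ h h' => TameOn.mul h h'
  | succ n ih =>
    intro u u' hu hu' h h'
    refine ⟨h.1.mul h'.1, ?_, ?_⟩ <;> simp only [dirD_mul (hu _) (hu' _)]
    · have d := fun ε => contDiff_dirD (hu ε) v
      have d' := fun ε => contDiff_dirD (hu' ε) v
      exact (ih hu d' h.of_succ h'.2.1).add (fun ε => (hu ε).mul (d' ε))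
        (fun ε => (hu' ε).mul (d ε)) (ih hu' d h'.of_succ h.2.1)
    · have d := fun ε => contDiff_dirD (hu ε) w
      have d' := fun ε => contDiff_dirD (hu' ε) w
      exact (ih hu d' h.of_succ h'.2.2).add (fun ε => (hu ε).mul (d' ε))
        (fun ε => (hu' ε).mul (d ε)) (ih hu' d h'.of_succ h.2.2)

/-- Composition with a function all of whose derivatives are bounded preserves tame jets. -/
theorem JetTame.comp : ∀ {n : ℕ} {g : ℝ → ℝ}, ContDiff ℝ ∞ g →
    (∀ k : ℕ, ∃ C : ℝ, ∀ y, |iteratedDeriv k g y| ≤ C) → (∀ ε, ContDiff ℝ ∞ (u ε)) →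
    JetTame m v w K n u → JetTame m v w K n (fun ε z => g (u ε z)) := by
  intro n
  have h0 : ∀ {g : ℝ → ℝ}, (∀ k : ℕ, ∃ C : ℝ, ∀ y, |iteratedDeriv k g y| ≤ C) →
      TameOn m K (fun ε z => g (u ε z)) := fun {g} hg => by
    obtain ⟨C, hC⟩ := hg 0
    exact tameOn_of_bounded (C := C) (Eventually.of_forall fun ε z _ => by simpa using hC (u ε z))
  induction n with
  | zero => exact fun _ hgb _ _ => h0 hgb
  | succ n ih =>
    intro g hg hgb hu h
    have hg' : ContDiff ℝ ∞ (deriv g) := (contDiff_infty_iff_deriv.1 hg).2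
    have hgb' : ∀ k : ℕ, ∃ C : ℝ, ∀ y, |iteratedDeriv k (deriv g) y| ≤ C := fun k => by
      simpa only [← iteratedDeriv_succ'] using hgb (k + 1)
    refine ⟨h0 hgb, ?_, ?_⟩ <;> simp only [dirD_comp hg (hu _)]
    · exact (ih hg' hgb' hu h.of_succ).mul (fun ε => hg'.comp (hu ε))
        (fun ε => contDiff_dirD (hu ε) v) h.2.1
    · exact (ih hg' hgb' hu h.of_succ).mul (fun ε => hg'.comp (hu ε))
        (fun ε => contDiff_dirD (hu ε) w) h.2.2

/-- A derivative in a direction of the span of `v`, `w` lowers the order of the jet by one. -/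
theorem JetTame.dirD_comb (hu : ∀ ε, ContDiff ℝ ∞ (u ε)) (h : JetTame m v w K (n + 1) u)
    (α β : ℝ) : JetTame m v w K n (fun ε => dirD (α • v + β • w) (u ε)) := by
  simp only [Colombeau.dirD_comb]
  have d := fun ε => contDiff_dirD (hu ε) v
  have d' := fun ε => contDiff_dirD (hu ε) w
  exact ((jetTame_const α n).mul (fun _ => contDiff_const) d h.2.1).add
    (fun ε => contDiff_const.mul (d ε)) (fun ε => contDiff_const.mul (d' ε))
    ((jetTame_const β n).mul (fun _ => contDiff_const) d' h.2.2)

/-- Tame jets along `v`, `w` are tame along any two directions in the span of `v`, `w`. -/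
theorem JetTame.change (α β α' β' : ℝ) : ∀ {n : ℕ} {u : Eps → E → ℝ},
    (∀ ε, ContDiff ℝ ∞ (u ε)) → JetTame m v w K n u →
    JetTame m (α • v + β • w) (α' • v + β' • w) K n u := by
  intro n
  induction n with
  | zero => exact fun _ h => h
  | succ n ih =>
    intro u hu h
    exact ⟨h.1, ih (fun ε => contDiff_dirD (hu ε) _) (h.dirD_comb hu α β),
      ih (fun ε => contDiff_dirD (hu ε) _) (h.dirD_comb hu α' β')⟩

theorem JetTame.iterate : ∀ {a b : ℕ} {u : Eps → E → ℝ}, (∀ ε, ContDiff ℝ ∞ (u ε)) →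
    JetTame m v w K (a + b) u → TameOn m K (fun ε => (dirD v)^[a] ((dirD w)^[b] (u ε))) := by
  intro a b
  induction b with
  | zero =>
    induction a with
    | zero => exact fun _ h => h
    | succ a ih =>
      intro u hu h
      rw [Nat.add_right_comm] at h
      exact ih (fun ε => contDiff_dirD (hu ε) v) h.2.1
  | succ b ih => exact fun hu h => ih (fun ε => contDiff_dirD (hu ε) w) h.2.2

/-- As derivatives commute, it suffices to control those of the form `∂ᵥᵃ ∂_wᵇ u`. -/
theorem jetTame_of_iterate (hu : ∀ ε, ContDiff ℝ ∞ (u ε)) (N : ℕ)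
    (h : ∀ a b : ℕ, a + b ≤ N → TameOn m K (fun ε => (dirD v)^[a] ((dirD w)^[b] (u ε)))) :
    JetTame m v w K N u := by
  suffices ∀ n a b : ℕ, n + (a + b) ≤ N →
      JetTame m v w K n (fun ε => (dirD v)^[a] ((dirD w)^[b] (u ε))) from this N 0 0 le_rfl
  intro n
  induction n with
  | zero => exact fun a b hab => h a b (by omega)
  | succ n ih =>
    refine fun a b hab => ⟨h a b (by omega), ?_, ?_⟩
    · simpa only [Function.iterate_succ_apply'] using ih (a + 1) b (by omega)
    · have := ih a (b + 1) (by omega)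
      simpa only [Function.iterate_succ_apply',
        dirD_iterate_comm (contDiff_dirD_iterate (hu _) w b)] using this

theorem JetTame.mono {K' : Set E} (hK : K' ⊆ K) : ∀ {n : ℕ} {u : Eps → E → ℝ},
    JetTame m v w K n u → JetTame m v w K' n u := by
  intro n
  induction n with
  | zero => exact fun h => TameOn.mono h hK
  | succ n ih => exact fun h => ⟨h.1.mono hK, ih h.2.1, ih h.2.2⟩

end Jet

/-! ### Derivative estimates for solutions of the semilinear wave equation -/

theorem dirD_iterate_initial {F : ℝ × ℝ → ℝ} (b : ℕ) : ContDiff ℝ ∞ F → ∀ x : ℝ,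
    (dirD (0, 1))^[b] F (0, x) = iteratedDeriv b (fun x => F (0, x)) x := by
  induction b generalizing F with
  | zero => intro _ x; simp
  | succ b ih =>
    intro hF x
    rw [Function.iterate_succ_apply, ih (contDiff_dirD hF _), iteratedDeriv_succ']
    congr 1
    funext y
    exact ((hF.differentiable (by simp) (0, y)).hasFDerivAt.comp_hasDerivAt y
      ((hasDerivAt_const y (0 : ℝ)).prodMk (hasDerivAt_id y))).deriv.symm

/-- A net of smooth solutions of `∂ₜ²u - ∂ₓ²u = λ g(u)` for `|t| < R`, where `|λ| ≤ 1` and all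
derivatives of `g` are bounded. The wave operator is written as `-(∂ₓ + ∂ₜ)(∂ₓ - ∂ₜ)`. -/
structure IsWaveNet (R : ℝ) (g : ℝ → ℝ) (lam : Eps → ℝ) (u : Eps → ℝ × ℝ → ℝ) : Prop where
  pos : 0 < R
  smooth : ∀ ε, ContDiff ℝ ∞ (u ε)
  smooth_g : ContDiff ℝ ∞ g
  bounded_g : ∀ k : ℕ, ∃ C : ℝ, ∀ y, |iteratedDeriv k g y| ≤ C
  abs_lam : ∀ ε, |lam ε| ≤ 1
  eqn : ∀ ε, ∀ z : ℝ × ℝ, |z.1| < R →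
    dirD (1, 1) (dirD (-1, 1) (u ε)) z = -(lam ε * g (u ε z))

namespace IsWaveNet

variable {R : ℝ} {g : ℝ → ℝ} {lam : Eps → ℝ} {u : Eps → ℝ × ℝ → ℝ} {m : ℕ}

theorem isOpen_slab (R : ℝ) : IsOpen {z : ℝ × ℝ | |z.1| < R} :=
  isOpen_lt (by fun_prop) continuous_const

theorem smooth_rhs (h : IsWaveNet R g lam u) (r : ℝ) (ε : Eps) :
    ContDiff ℝ ∞ (fun z => r * g (u ε z)) :=
  contDiff_const.mul (h.smooth_g.comp (h.smooth ε))

theorem jetTame_rhs (h : IsWaveNet R g lam u) {v w : ℝ × ℝ} {K : Set (ℝ × ℝ)} {n : ℕ}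
    {r : Eps → ℝ} (hr : ∀ ε, |r ε| ≤ 1) (hj : JetTame m v w K n u) :
    JetTame m v w K n (fun ε z => r ε * g (u ε z)) :=
  (jetTame_scalar hr n).mul (fun _ => contDiff_const)
    (fun ε => h.smooth_g.comp (h.smooth ε)) (hj.comp h.smooth_g h.bounded_g h.smooth)

theorem eqn_char (h : IsWaveNet R g lam u) {σ : ℝ} (hσ : σ = 1 ∨ σ = -1) (ε : Eps) :
    EqOn (dirD (-σ, 1) (dirD (σ, 1) (u ε))) (fun z => -lam ε * g (u ε z))
      {z : ℝ × ℝ | |z.1| < R} := by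
  intro z hz
  have := h.eqn ε z hz
  rcases hσ with rfl | rfl
  · rw [dirD_comm (h.smooth ε), this]; ring
  · rw [neg_neg, this]; ring

theorem eqn_dt (h : IsWaveNet R g lam u) (ε : Eps) :
    EqOn (dirD (1, 0) (dirD (1, 0) (u ε)))
      (fun z => dirD (0, 1) (dirD (0, 1) (u ε)) z + 1 * (lam ε * g (u ε z)))
      {z : ℝ × ℝ | |z.1| < R} := by
  intro z hz
  have h1 := h.eqn ε z hz
  have hs := h.smooth ε
  have e1 : ((1 : ℝ), (1 : ℝ)) = (1 : ℝ) • ((1 : ℝ), (0 : ℝ)) + (1 : ℝ) • ((0 : ℝ), (1 : ℝ)) := by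
    ext <;> simp
  have e2 : ((-1 : ℝ), (1 : ℝ)) = (-1 : ℝ) • ((1 : ℝ), (0 : ℝ)) + (1 : ℝ) • ((0 : ℝ), (1 : ℝ)) := by
    ext <;> simp
  have d0 := contDiff_dirD hs (0, 1)
  have d1 := contDiff_dirD hs (1, 0)
  rw [e2, dirD_comb, e1, dirD_comb,
    dirD_add (contDiff_const.mul d1) (contDiff_const.mul d0),
    dirD_add (contDiff_const.mul d1) (contDiff_const.mul d0), dirD_mul contDiff_const d1,
    dirD_mul contDiff_const d0, dirD_mul contDiff_const d1, dirD_mul contDiff_const d0,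
    dirD_comm hs (1, 0) (0, 1)] at h1
  simp only [dirD_const] at h1
  linarith

/-- At `t = 0` the equation expresses all derivatives by those of the initial data. -/
theorem jetTame_initial (h : IsWaveNet R g lam u) {P : Set ℝ}
    (h₀ : ∀ k, TameOn m P fun ε => iteratedDeriv k fun x => u ε (0, x))
    (h₁ : ∀ k, TameOn m P fun ε => iteratedDeriv k fun x => dirD (1, 0) (u ε) (0, x)) (n : ℕ) :
    JetTame m (0, 1) (1, 0) ({0} ×ˢ P) n u := by
  have hpull : ∀ {φ : Eps → ℝ × ℝ → ℝ} {ψ : Eps → ℝ → ℝ}, TameOn m P ψ →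
      (∀ ε x, φ ε (0, x) = ψ ε x) → TameOn m ({0} ×ˢ P) φ := by
    rintro φ ψ ⟨n, C, hC⟩ hφ
    refine ⟨n, C, hC.mono ?_⟩
    rintro ε hε ⟨t, x⟩ ⟨rfl, hx⟩
    rw [hφ]
    exact hε x hx
  have hw : ∀ b, TameOn m ({0} ×ˢ P) fun ε => (dirD (0, 1))^[b] (u ε) := fun b =>
    hpull (h₀ b) fun ε x => dirD_iterate_initial b (h.smooth ε) x
  induction n with
  | zero => exact hw 0
  | succ n ih =>
    have hrhs := h.jetTame_rhs h.abs_lam ih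
    suffices ∀ a b, b + a ≤ n + 1 → TameOn m ({0} ×ˢ P)
        fun ε => (dirD (0, 1))^[b] ((dirD (1, 0))^[a] (u ε)) from
      jetTame_of_iterate h.smooth _ fun b a hab => this a b hab
    intro a
    induction a using Nat.twoStepInduction with
    | zero => exact fun b _ => hw b
    | one =>
      exact fun b _ => hpull (h₁ b) fun ε x =>
        dirD_iterate_initial b (contDiff_dirD (h.smooth ε) _) x
    | more a iha _ =>
      intro b hab
      have h2 := (iha (b + 2) (by omega)).add ((tameOn_const 1).mul
        (JetTame.iterate (a := b) (b := a) (fun ε => h.smooth_rhs (lam ε) ε)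
          (hrhs.of_le (by omega))))
      refine h2.congr fun ε z hz => ?_
      have hs := h.smooth ε
      have hX := contDiff_dirD (contDiff_dirD hs (0, 1)) (0, 1)
      have h3 := dirD_iterate_eqOn (isOpen_slab R)
        (dirD_iterate_eqOn (isOpen_slab R) (h.eqn_dt ε) (1, 0) a) (0, 1) b
        (show |z.1| < R by rw [hz.1, abs_zero]; exact h.pos)
      rw [dirD_iterate_comb (F := dirD (0, 1) (dirD (0, 1) (u ε))) hX (h.smooth_rhs (lam ε) ε),
        dirD_iterate_comb (contDiff_dirD_iterate hX _ _)
          (contDiff_dirD_iterate (h.smooth_rhs (lam ε) ε) _ _)] at h3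
      change _ = (dirD (0, 1))^[b] ((dirD (0, 1))^[2] ((dirD (1, 0))^[a] (u ε))) z + _
      rw [dirD_iterate_iterate_comm hs (0, 1) (1, 0) a 2]
      exact h3

/-- The part of the slab `0 ≤ t ≤ T` that is covered by the characteristics of slope `-σ` starting
at the points of `{0} × P`. -/
def charSet (T σ : ℝ) (P : Set ℝ) : Set (ℝ × ℝ) := {z | 0 ≤ z.1 ∧ z.1 ≤ T ∧ z.2 + σ * z.1 ∈ P}

/-- Transport along characteristics: a derivative along `(σ, 1)` satisfies an ordinary differential
equation along the characteristics with direction `(-σ, 1)`, whose right-hand side contains only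
derivatives along `(σ, 1)` of lower order. Hence the estimates for the initial data over `P` are
propagated to `charSet T σ P`, whatever happens elsewhere. -/
theorem jetTame_char (h : IsWaveNet R g lam u) {P : Set ℝ} {T σ : ℝ} (hσ : σ = 1 ∨ σ = -1)
    (hTR : T < R) (h0 : TameOn m (charSet T σ P) u)
    (hinit : ∀ n, JetTame m (0, 1) (1, 0) ({0} ×ˢ P) n u) (n : ℕ) :
    JetTame m (σ, 1) (σ, 1) (charSet T σ P) n u := by
  induction n with
  | zero => exact h0
  | succ n ih =>
    refine jetTame_of_iterate h.smooth _ fun a b hab => ?_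
    simp only [← Function.iterate_add_apply]
    rcases Nat.lt_or_ge (a + b) (n + 1) with hlt | hge
    · have := JetTame.iterate (a := a) (b := b) h.smooth (ih.of_le (by omega))
      simpa only [← Function.iterate_add_apply] using this
    rw [show a + b = n + 1 by omega]
    -- the derivative of `∂_σⁿ⁺¹ u` along the characteristic is `∂_σⁿ (-λ g(u))`
    have hrhs := JetTame.iterate (a := n) (b := 0) (fun ε => h.smooth_rhs (-lam ε) ε)
      (h.jetTame_rhs (r := fun ε => -lam ε) (fun ε => (abs_neg _).trans_le (h.abs_lam ε)) ih)
    have hstart : TameOn m ({0} ×ˢ P) fun ε => (dirD (σ, 1))^[n + 1] (u ε) := by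
      have := JetTame.iterate (a := n + 1) (b := 0) h.smooth
        ((hinit (n + 1)).change 1 σ 1 σ h.smooth)
      simpa using this
    obtain ⟨n₁, C₁, hC₁⟩ := hstart
    obtain ⟨n₂, C₂, hC₂⟩ := hrhs
    refine ((tameOn_rate C₁ n₁).add ((tameOn_const T).mul (tameOn_rate C₂ n₂))).of_eventually_le
      ((hC₁.and hC₂).mono ?_)
    rintro ε ⟨h₁, h₂⟩ ⟨t, x⟩ ⟨ht0, htT, hx⟩
    dsimp only at ht0 htT hx
    refine le_trans ?_ (le_abs_self _)
    have hF := contDiff_dirD_iterate (h.smooth ε) (σ, 1) (n + 1)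
    set F := (dirD (σ, 1))^[n + 1] (u ε) with hFdef
    have hσ2 : σ * σ = 1 := by rcases hσ with rfl | rfl <;> norm_num
    have hσ1 : |σ| = 1 := by rcases hσ with rfl | rfl <;> norm_num
    have hd : ∀ s, HasDerivAt (fun s => F (t - s, x + σ * s))
        (σ * dirD (-σ, 1) F (t - s, x + σ * s)) s := by
      intro s
      have h1 := (hF.differentiable (by simp) (t - s, x + σ * s)).hasFDerivAt.comp_hasDerivAt s
        (((hasDerivAt_id s).const_sub t).prodMk (((hasDerivAt_id s).const_mul σ).const_add x))
      refine h1.congr_deriv ?_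
      have h2 : ((-1 : ℝ), σ * 1) = σ • (-σ, (1 : ℝ)) := by ext <;> simp [hσ2]
      rw [h2, map_smul]
      rfl
    have hbound : ∀ s ∈ Icc 0 t, |σ * dirD (-σ, 1) F (t - s, x + σ * s)| ≤
        C₂ * (ε : ℝ) ^ (-((m : ℝ) * n₂)) := by
      intro s hs
      have hz : (t - s, x + σ * s) ∈ charSet T σ P := by
        refine ⟨by linarith [hs.2], by linarith [hs.1], ?_⟩
        rwa [show x + σ * s + σ * (t - s) = x + σ * t by ring]
      have hz' : |t - s| < R := by
        rw [abs_of_nonneg hz.1]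
        exact hz.2.1.trans_lt hTR
      rw [abs_mul, hσ1, one_mul, hFdef, dirD_iterate_comm (h.smooth ε), Function.iterate_succ_apply,
        dirD_comm (h.smooth ε), dirD_iterate_eqOn (isOpen_slab R) (h.eqn_char hσ ε) (σ, 1) n hz']
      exact h₂ _ hz
    -- mean value inequality on the characteristic from `(t, x)` down to `(0, x + σ t)`
    have hmv := Convex.norm_image_sub_le_of_norm_hasDerivWithin_le (s := Icc 0 t) (x := t) (y := 0)
      (fun s _ => (hd s).hasDerivWithinAt) hbound (convex_Icc 0 t) (right_mem_Icc.2 ht0)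
      (left_mem_Icc.2 ht0)
    simp only [sub_zero, mul_zero, add_zero, sub_self, Real.norm_eq_abs, zero_sub, abs_neg,
      abs_of_nonneg ht0] at hmv
    have h3 := h₁ (0, x + σ * t) ⟨rfl, hx⟩
    have h4 : 0 ≤ C₂ * (ε : ℝ) ^ (-((m : ℝ) * n₂)) :=
      (abs_nonneg _).trans (hbound 0 (left_mem_Icc.2 ht0))
    have h5 := mul_le_mul_of_nonneg_left htT h4
    have h6 := abs_sub_abs_le_abs_sub (F (t, x)) (F (0, x + σ * t))
    linarith

/-- Away from pure derivatives along the two characteristic directions, every derivative of a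
solution contains the wave operator and is expressed by lower derivatives. -/
theorem jetTame_of_char (h : IsWaveNet R g lam u) {K : Set (ℝ × ℝ)} (hK : ∀ z ∈ K, |z.1| < R)
    (hpos : ∀ n, JetTame m (1, 1) (1, 1) K n u) (hneg : ∀ n, JetTame m (-1, 1) (-1, 1) K n u)
    (n : ℕ) : JetTame m (1, 1) (-1, 1) K n u := by
  induction n with
  | zero => exact hpos 0
  | succ n ih =>
    refine jetTame_of_iterate h.smooth _ fun a b hab => ?_
    rcases b with _ | b
    · exact JetTame.iterate (w := ((1 : ℝ), (1 : ℝ))) (a := a) (b := 0) h.smooth (hpos _)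
    rcases a with _ | a
    · exact JetTame.iterate (v := ((-1 : ℝ), (1 : ℝ))) (a := 0) (b := b + 1) h.smooth (hneg _)
    have hrhs := JetTame.iterate (a := a) (b := b) (fun ε => h.smooth_rhs (-lam ε) ε)
      ((h.jetTame_rhs (r := fun ε => -lam ε) (fun ε => (abs_neg _).trans_le (h.abs_lam ε)) ih).of_le
        (by omega))
    refine hrhs.congr fun ε z hz => ?_
    rw [Function.iterate_succ_apply, Function.iterate_succ_apply (dirD (-1, 1)) b,
      dirD_iterate_comm (contDiff_dirD (h.smooth ε) _)]
    refine dirD_iterate_eqOn (isOpen_slab R) (dirD_iterate_eqOn (isOpen_slab R) ?_ (-1, 1) b)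
      (1, 1) a (hK z hz)
    intro z hz
    rw [h.eqn ε z hz]
    ring

end IsWaveNet

/-! ### Representatives that are smooth on the whole space -/

section Smooth

variable {E : Type*} [NormedAddCommGroup E] [NormedSpace ℝ E] {S : Domain E}

theorem derivSize_of_smooth {u : Eps → E → ℝ} {ε : Eps} (hu : ContDiff ℝ ∞ (u ε)) (k : ℕ) {z : E}
    (hz : z ∈ S.carrier) : derivSize S u k ε z = ‖iteratedFDeriv ℝ k (u ε) z‖ := by
  unfold derivSize
  rw [iteratedFDerivWithin_eq_iteratedFDeriv S.uniqueDiffOn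
    ((contDiff_infty.1 hu k).contDiffAt) hz]

theorem contDiff_foldr_dirD {F : E → ℝ} (hF : ContDiff ℝ ∞ F) (vs : List E) :
    ContDiff ℝ ∞ (vs.foldr dirD F) := by
  induction vs with
  | nil => exact hF
  | cons v vs ih => exact contDiff_dirD ih v

theorem derivNet_of_eqOn {w u : Eps → E → ℝ} (hu : ∀ ε, ContDiff ℝ ∞ (u ε))
    (h : ∀ ε, EqOn (w ε) (u ε) S.carrier) (v : E) (ε : Eps) :
    EqOn (derivNet S v w ε) (dirD v (u ε)) S.carrier := fun z hz => by
  simp only [derivNet, dirD]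
  rw [fderivWithin_congr (h ε) (h ε hz),
    ((hu ε).differentiable (by simp) z).fderivWithin (S.uniqueDiffOn z hz)]

/-- Iterated derivatives of a class are represented by ordinary iterated derivatives if the
representative is smooth on the whole space. -/
theorem exists_foldr_partialD_eq (u : moderateNets S) (hu : ∀ ε, ContDiff ℝ ∞ (u.1 ε))
    (vs : List E) : ∃ w : moderateNets S, vs.foldr partialD (GenFun.mk S u) = GenFun.mk S w ∧
      ∀ ε, EqOn (w.1 ε) (vs.foldr dirD (u.1 ε)) S.carrier := by
  induction vs with
  | nil => exact ⟨u, rfl, fun ε z _ => rfl⟩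
  | cons v vs ih =>
    obtain ⟨w, hw, hwe⟩ := ih
    refine ⟨⟨derivNet S v w.1, derivNet_mem v w⟩, ?_, fun ε =>
      derivNet_of_eqOn (fun ε => contDiff_foldr_dirD (hu ε) vs) hwe v ε⟩
    rw [List.foldr_cons, hw]
    rfl

theorem mk_eq_of_eventually_eqOn {u w : moderateNets S}
    (h : ∀ᶠ ε in toZero, EqOn (u.1 ε) (w.1 ε) S.carrier) : GenFun.mk S u = GenFun.mk S w := by
  refine Ideal.Quotient.eq.2 fun K hKS _ k a _ => ⟨0, h.mono fun ε hε x hx => ?_⟩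
  have h1 : EqOn ((u - w).1 ε) (fun _ => 0) S.carrier := fun z hz => sub_eq_zero.2 (hε hz)
  have h2 : derivSize S (u - w).1 k ε x = 0 := by
    unfold derivSize
    rw [iteratedFDerivWithin_congr h1 (hKS hx)]
    simp [iteratedFDerivWithin_fun_zero]
  rw [h2]
  simp

/-- Bounded type on a compact set can be tested on any representative. -/
theorem BoundedTypeOn.tameOn {U : GenFun S} {K : Set E} (h : BoundedTypeOn U K)
    (hKS : K ⊆ S.carrier) (hK : IsCompact K) {u : moderateNets S} (hu : GenFun.mk S u = U) :
    TameOn 0 K u.1 := by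
  obtain ⟨w, hw, C, hC⟩ := h
  obtain ⟨D, hD⟩ := Ideal.Quotient.eq.1 (hu.trans hw.symm) K hKS hK 0 0 le_rfl
  refine tameOn_of_bounded (C := C + D) ((hC.and hD).mono fun ε hε x hx => ?_)
  have h1 := hε.1 x hx
  have h2 := hε.2 x hx
  simp only [derivSize, norm_iteratedFDerivWithin_zero, Real.rpow_zero, mul_one,
    Real.norm_eq_abs] at h2
  have h3 : |u.1 ε x - w.1 ε x| ≤ D := (abs_abs _).symm.trans_le h2
  have h4 := abs_sub_abs_le_abs_sub (u.1 ε x) (w.1 ε x)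
  linarith

end Smooth

section Plane

variable {m n : ℕ} {K : Set (ℝ × ℝ)} {u : Eps → ℝ × ℝ → ℝ}

theorem JetTame.tameOn_iteratedFDeriv : ∀ {k : ℕ} {u : Eps → ℝ × ℝ → ℝ},
    (∀ ε, ContDiff ℝ ∞ (u ε)) → JetTame m (1, 0) (0, 1) K k u →
    TameOn m K (fun ε z => ‖iteratedFDeriv ℝ k (u ε) z‖) := by
  intro k
  induction k with
  | zero => exact fun _ h => TameOn.of_le h fun ε z _ => by simp
  | succ k ih =>
    intro u hu h
    let A : ℝ × ℝ →L[ℝ] ℝ := ContinuousLinearMap.fst ℝ ℝ ℝ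
    let B : ℝ × ℝ →L[ℝ] ℝ := ContinuousLinearMap.snd ℝ ℝ ℝ
    have d := fun ε => contDiff_dirD (hu ε) (1, 0)
    have d' := fun ε => contDiff_dirD (hu ε) (0, 1)
    have h1 := ((tameOn_const (m := m) (K := K) ‖ContinuousLinearMap.toSpanSingleton ℝ A‖).mul
      (ih d h.2.1)).add
        ((tameOn_const ‖ContinuousLinearMap.toSpanSingleton ℝ B‖).mul (ih d' h.2.2))
    refine h1.of_le fun ε z _ => ?_
    rw [abs_norm]
    refine le_trans ?_ (le_abs_self _)
    have heq : fderiv ℝ (u ε) = (ContinuousLinearMap.toSpanSingleton ℝ A ∘ dirD (1, 0) (u ε)) +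
        (ContinuousLinearMap.toSpanSingleton ℝ B ∘ dirD (0, 1) (u ε)) := by
      funext z
      ext <;> simp [A, B, dirD]
    have hk : ((k : ℕ∞) : WithTop ℕ∞) ≤ ∞ := by exact_mod_cast le_top
    rw [← norm_iteratedFDeriv_fderiv, heq, iteratedFDeriv_add_apply
      (((ContinuousLinearMap.contDiff _).comp (d ε)).of_le hk).contDiffAt
      (((ContinuousLinearMap.contDiff _).comp (d' ε)).of_le hk).contDiffAt]
    exact (norm_add_le _ _).trans (add_le_add
      (ContinuousLinearMap.norm_iteratedFDeriv_comp_left _ (d ε).contDiffAt hk)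
      (ContinuousLinearMap.norm_iteratedFDeriv_comp_left _ (d' ε).contDiffAt hk))

theorem JetTame.tameOn_foldr (hu : ∀ ε, ContDiff ℝ ∞ (u ε))
    (h : ∀ n, JetTame m (1, 0) (0, 1) K n u) (vs : List (ℝ × ℝ)) :
    TameOn m K (fun ε => vs.foldr dirD (u ε)) := by
  suffices ∀ n, JetTame m (1, 0) (0, 1) K n (fun ε => vs.foldr dirD (u ε)) from this 0
  induction vs with
  | nil => exact h
  | cons v vs ih =>
    intro n
    have hv : v = v.1 • ((1 : ℝ), (0 : ℝ)) + v.2 • ((0 : ℝ), (1 : ℝ)) := by ext <;> simp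
    rw [hv]
    exact (ih (n + 1)).dirD_comb (fun ε => contDiff_foldr_dirD (hu ε) vs) _ _

theorem JetTame.of_char (hu : ∀ ε, ContDiff ℝ ∞ (u ε)) (h : JetTame m (1, 1) (-1, 1) K n u) :
    JetTame m (1, 0) (0, 1) K n u := by
  have := h.change (1 / 2) (-1 / 2) (1 / 2) (1 / 2) hu
  norm_num at this
  exact this

end Plane

/-! ### Truncation of the nonlinearity -/

theorem exists_truncation {f : ℝ → ℝ} (hf : ContDiff ℝ ∞ f) (M : ℝ) :
    ∃ g : ℝ → ℝ, ContDiff ℝ ∞ g ∧ (∀ k : ℕ, ∃ C : ℝ, ∀ y, |iteratedDeriv k g y| ≤ C) ∧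
      ∀ y, |y| ≤ M → g y = f y := by
  let χ : ContDiffBump (0 : ℝ) := ⟨|M| + 1, |M| + 2, by positivity, by linarith⟩
  have hg : ContDiff ℝ ∞ fun y => χ y * f y := χ.contDiff.mul hf
  refine ⟨fun y => χ y * f y, hg, fun k => ?_, fun y hy => ?_⟩
  · have hc : HasCompactSupport fun y => χ y * f y := χ.hasCompactSupport.mul_right
    obtain ⟨C, hC⟩ := (hg.continuous_iteratedFDeriv (m := k)
      (by exact_mod_cast le_top)).bounded_above_of_compact_support (hc.iteratedFDeriv (𝕜 := ℝ) k)
    exact ⟨C, fun y => by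
      simpa [norm_iteratedFDeriv_eq_norm_iteratedDeriv] using hC y⟩
  · have : χ y = 1 := χ.one_of_mem_closedBall (by
      simp only [Metric.mem_closedBall, dist_zero_right, Real.norm_eq_abs, χ]
      linarith [le_abs_self M])
    simp [this]

theorem abs_sub_le_of_bounded_deriv {g : ℝ → ℝ} (hg : ContDiff ℝ ∞ g) {L : ℝ}
    (hL : ∀ y, |deriv g y| ≤ L) (y z : ℝ) : |g y - g z| ≤ L * |y - z| :=
  convex_univ.norm_image_sub_le_of_norm_deriv_le
    (fun x _ => hg.differentiable (by simp) x) (fun x _ => hL x) (mem_univ z) (mem_univ y)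

/-! ### Initial data with compact support -/

theorem contDiff_rep (u : moderateNets line) (ε : Eps) : ContDiff ℝ ∞ (u.1 ε) :=
  contDiffOn_univ.1 (u.2.1 ε)

theorem NegOn.union {X : Type*} {K K' : Set X} {φ : Eps → X → ℝ} (h : NegOn K φ)
    (h' : NegOn K' φ) : NegOn (K ∪ K') φ := by
  intro a ha
  obtain ⟨C, hC⟩ := h a ha
  obtain ⟨D, hD⟩ := h' a ha
  refine ⟨max C D, (hC.and hD).mono fun ε hε x hx => ?_⟩
  have h0 : 0 ≤ (ε : ℝ) ^ a := Real.rpow_nonneg ε.2.1.le _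
  rcases hx with hx | hx
  · exact (hε.1 x hx).trans (mul_le_mul_of_nonneg_right (le_max_left _ _) h0)
  · exact (hε.2 x hx).trans (mul_le_mul_of_nonneg_right (le_max_right _ _) h0)

theorem NegOn.mono {X : Type*} {K K' : Set X} {φ : Eps → X → ℝ} (h : NegOn K φ)
    (hK : K' ⊆ K) : NegOn K' φ := by
  intro a ha
  obtain ⟨C, hC⟩ := h a ha
  exact ⟨C, hC.mono fun ε hε x hx => hε x (hK hx)⟩

/-- A representative is negligible on the compact sets that do not meet the support. -/
theorem negOn_of_disjoint_supp (u : moderateNets line) {K : Set ℝ} (hK : IsCompact K)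
    (hd : Disjoint K (supp (GenFun.mk line u))) (k : ℕ) : NegOn K (derivSize line u.1 k) := by
  refine hK.induction_on (p := fun s => NegOn s (derivSize line u.1 k)) ?_ ?_ ?_ ?_
  · exact fun a _ => ⟨0, Eventually.of_forall fun ε x hx => hx.elim⟩
  · exact fun s t hst ht => ht.mono hst
  · exact fun s t hs ht => hs.union ht
  · intro x hx
    have hx' := disjoint_left.1 hd hx
    simp only [supp, line, Set.mem_sdiff, mem_univ, true_and, not_not, mem_iUnion] at hx'
    obtain ⟨O, hO, hxO⟩ := hx'
    obtain ⟨C, hC, hxC, hCO⟩ := exists_compact_subset O.isOpen hxO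
    refine ⟨C, mem_nhdsWithin_of_mem_nhds (mem_interior_iff_mem_nhds.1 hxC), ?_⟩
    have h1 := Ideal.Quotient.eq_zero_iff_mem.1 hO C (fun y hy => ⟨mem_univ y, hCO hy⟩) hC k
    exact h1.of_le fun ε y hy => (congrArg abs (derivSize_interOpen line O u.1 k ε (hCO hy))).ge

theorem smooth_const_mem_moderateNets {F : ℝ → ℝ} (hF : ContDiff ℝ ∞ F) :
    (fun (_ : Eps) => F) ∈ moderateNets line := by
  refine ⟨fun ε => hF.contDiffOn, fun K _ hK k => ?_⟩
  obtain ⟨C, hC⟩ := hK.exists_bound_of_continuousOn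
    (hF.continuous_iteratedFDeriv (m := k) (by exact_mod_cast le_top)).continuousOn
  refine (modOn_const C).of_le fun ε x hx => ?_
  rw [derivSize_of_smooth hF k (mem_univ x), abs_norm]
  exact (hC x hx).trans (le_abs_self C)

/-- A generalized function with compact support has a representative that vanishes outside a fixed
compact set: multiplication by a cutoff changes any representative by a negligible net. -/
theorem exists_rep_eq_zero (U : GenFun line) (hU : IsCompact (supp U)) :
    ∃ (u : moderateNets line) (R : ℝ), 0 < R ∧ GenFun.mk line u = U ∧
      ∀ ε x, R ≤ |x| → u.1 ε x = 0 := by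
  obtain ⟨w, rfl⟩ := Ideal.Quotient.mk_surjective U
  obtain ⟨r, hr⟩ := hU.isBounded.exists_pos_norm_lt
  obtain ⟨hr0, hr⟩ := hr
  let χ : ContDiffBump (0 : ℝ) := ⟨r, r + 1, hr0, by linarith⟩
  let c : moderateNets line := ⟨fun _ => χ, smooth_const_mem_moderateNets χ.contDiff⟩
  refine ⟨c * w, r + 1, by linarith, ?_, fun ε x hx => ?_⟩
  · refine Ideal.Quotient.eq.2 fun K hKS hK k => ?_
    have hneg : NegOn (K ∩ {x | r ≤ |x|}) (derivSize line (c * w - w).1 k) := by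
      have hK' : IsCompact (K ∩ {x | r ≤ |x|}) :=
        hK.inter_right (isClosed_le continuous_const continuous_abs)
      have h1 : ∀ j, NegOn (K ∩ {x | r ≤ |x|}) (derivSize line w.1 j) := fun j => by
        refine negOn_of_disjoint_supp w hK' (disjoint_left.2 fun x hx hx' => ?_) j
        exact absurd (hr x hx') (not_lt.2 hx.2)
      have h2 : (c * w - w).1 = (c - 1).1 * w.1 := by
        rw [← Subring.coe_mul, sub_mul, one_mul]
      rw [h2]
      refine NegOn.of_le (NegOn.sum (Finset.range (k + 1)) fun i _ =>
        ((modOn_const (k.choose i : ℝ)).mul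
          ((c - 1).2.2 _ (subset_univ _) hK' i)).mul_negOn (h1 (k - i))) ?_
      exact fun ε x hx => abs_le_abs_of_derivSize_le
        (derivSize_mul_le (c - 1).2.1 w.2.1 k ε (mem_univ x))
    have hzero : NegOn {x : ℝ | |x| < r} (derivSize line (c * w - w).1 k) := by
      refine fun a _ => ⟨0, Eventually.of_forall fun ε x hx => ?_⟩
      have h1 : (c * w - w).1 ε =ᶠ[𝓝 x] fun _ => 0 := by
        filter_upwards [(isOpen_lt continuous_abs continuous_const).mem_nhds hx] with y hy
        have h2 : χ y = 1 := χ.one_of_mem_closedBall (by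
          simpa [χ] using le_of_lt hy)
        change χ y * w.1 ε y - w.1 ε y = 0
        rw [h2, one_mul, sub_self]
      rw [derivSize_of_smooth (contDiff_rep (c * w - w) ε) k (mem_univ x),
        (h1.iteratedFDeriv ℝ k).eq_of_nhds]
      simp [iteratedFDeriv_fun_zero]
    refine (hneg.union hzero).mono fun x hx => ?_
    rcases le_or_gt r |x| with h | h
    · exact Or.inl ⟨hx, h⟩
    · exact Or.inr h
  · change χ x * w.1 ε x = 0
    rw [χ.zero_of_le_dist (by simpa [χ] using hx), zero_mul]

theorem iteratedDeriv_eq_foldr (F : ℝ → ℝ) (k : ℕ) :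
    iteratedDeriv k F = (List.replicate k (1 : ℝ)).foldr dirD F := by
  induction k with
  | zero => simp
  | succ k ih =>
    rw [iteratedDeriv_succ, ih]
    funext x
    rfl

theorem tameOn_one_iteratedDeriv (u : moderateNets line) {P : Set ℝ} (hP : IsCompact P) (k : ℕ) :
    TameOn 1 P (fun ε => iteratedDeriv k (u.1 ε)) := by
  refine (tameOn_one_iff.2 (u.2.2 P (subset_univ P) hP k)).of_le fun ε x _ => ?_
  rw [derivSize_of_smooth (contDiff_rep u ε) k (mem_univ x), abs_norm,
    norm_iteratedFDeriv_eq_norm_iteratedDeriv, Real.norm_eq_abs]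

/-- If the class is in `𝒢⁰` off the origin, the derivatives of any representative are of bounded
type on the compact sets that do not contain `0`. -/
theorem tameOn_zero_iteratedDeriv (u : moderateNets line)
    (hu : IsG0 (restrictTo puncturedLine (GenFun.mk line u))) {P : Set ℝ} (hP : IsCompact P)
    (hP0 : (0 : ℝ) ∉ P) (k : ℕ) : TameOn 0 P (fun ε => iteratedDeriv k (u.1 ε)) := by
  have hsub : P ⊆ (line.interOpen puncturedLine).carrier := fun x hx =>
    ⟨mem_univ x, fun h => hP0 (h ▸ hx)⟩
  have hb := hu (List.replicate k 1) P hsub hP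
  obtain ⟨w, hw, hwe⟩ := exists_foldr_partialD_eq (S := line.interOpen puncturedLine)
    ⟨u.1, restrict_mem puncturedLine u⟩ (contDiff_rep u) (List.replicate k 1)
  refine (hb.tameOn hsub hP hw.symm).congr fun ε x hx => ?_
  rw [hwe ε (hsub hx), iteratedDeriv_eq_foldr]

theorem exists_bound_of_eq_zero (u : moderateNets line) {R : ℝ}
    (hR : ∀ ε x, R ≤ |x| → u.1 ε x = 0) (hu : BoundedTypeOn (GenFun.mk line u) univ) :
    ∃ C : ℝ, ∀ᶠ ε in toZero, ∀ x, |u.1 ε x| ≤ C := by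
  obtain ⟨w, hw, C, hC⟩ := hu
  have hb : BoundedTypeOn (GenFun.mk line u) (Icc (-R) R) :=
    ⟨w, hw, C, hC.mono fun ε h x _ => h x (mem_univ x)⟩
  obtain ⟨D, hD⟩ := tameOn_zero_iff.1 (hb.tameOn (subset_univ _) isCompact_Icc rfl)
  refine ⟨max D 0, hD.mono fun ε hε x => ?_⟩
  rcases le_or_gt R |x| with h | h
  · rw [hR ε x h, abs_zero]
    exact le_max_right _ _
  · exact (hε x (abs_le.1 h.le)).trans (le_max_left _ _)

/-- A net that vanishes for `|x| ≥ R` is bounded if its derivative is. -/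
theorem exists_bound_of_ddx (u : moderateNets line) {R : ℝ} (hR0 : 0 < R)
    (hR : ∀ ε x, R ≤ |x| → u.1 ε x = 0) (hu : BoundedTypeOn (ddx (GenFun.mk line u)) univ) :
    ∃ C : ℝ, ∀ᶠ ε in toZero, ∀ x, |u.1 ε x| ≤ C := by
  obtain ⟨w, hw, C, hC⟩ := hu
  have hb : BoundedTypeOn (ddx (GenFun.mk line u)) (Icc (-R) R) :=
    ⟨w, hw, C, hC.mono fun ε h x _ => h x (mem_univ x)⟩
  obtain ⟨D, hD⟩ := tameOn_zero_iff.1 (hb.tameOn (u := ⟨derivNet line 1 u.1, derivNet_mem 1 u⟩)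
    (subset_univ _) isCompact_Icc rfl)
  refine ⟨D * (2 * R), hD.mono fun ε hε x => ?_⟩
  have hD0 : 0 ≤ D := (abs_nonneg _).trans (hε R ⟨by linarith, le_rfl⟩)
  rcases le_or_gt R |x| with h | h
  · rw [hR ε x h, abs_zero]
    positivity
  · have hx := abs_lt.1 h
    have h1 := (convex_Icc (-R) R).norm_image_sub_le_of_norm_deriv_le (f := u.1 ε) (C := D)
      (fun y _ => (contDiff_rep u ε).differentiable (by simp) y) (fun y hy => ?_)
      (left_mem_Icc.2 (by linarith)) ⟨hx.1.le, hx.2.le⟩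
    · rw [hR ε (-R) (by rw [abs_neg, abs_of_pos hR0]), sub_zero, Real.norm_eq_abs,
        Real.norm_eq_abs, abs_of_nonneg (by linarith : 0 ≤ x - -R)] at h1
      exact h1.trans (mul_le_mul_of_nonneg_left (by linarith) hD0)
    · exact (congrArg abs (derivNet_of_eqOn (S := line) (contDiff_rep u)
        (fun ε z _ => rfl) 1 ε (mem_univ y))).ge.trans (hε y hy)

theorem abs_dAlembert_le {u₀ u₁ : ℝ → ℝ} {C₀ C₁ T : ℝ} (h₀ : ∀ x, |u₀ x| ≤ C₀)
    (h₁ : ∀ x, |u₁ x| ≤ C₁) {z : ℝ × ℝ} (hz0 : 0 ≤ z.1) (hzT : z.1 ≤ T) :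
    |dAlembert u₀ u₁ z| ≤ C₀ + C₁ * T := by
  have h2 := intervalIntegral.norm_integral_le_of_norm_le_const (f := u₁) (a := z.2 - z.1)
    (b := z.2 + z.1) (C := C₁) fun y _ => h₁ y
  rw [Real.norm_eq_abs, show z.2 + z.1 - (z.2 - z.1) = 2 * z.1 by ring,
    abs_of_nonneg (by positivity : 0 ≤ 2 * z.1)] at h2
  have hC1 : 0 ≤ C₁ := (abs_nonneg _).trans (h₁ 0)
  have h3 := mul_le_mul_of_nonneg_left hzT hC1
  have a1 := abs_le.1 (h₀ (z.2 + z.1))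
  have a2 := abs_le.1 (h₀ (z.2 - z.1))
  have a3 := abs_le.1 h2
  rw [dAlembert, abs_le]
  constructor <;> linarith [a1.1, a1.2, a2.1, a2.2, a3.1, a3.2]

/-! ### The generalized solution -/

theorem eventually_toZero_lt {δ : ℝ} (hδ : 0 < δ) : ∀ᶠ ε : Eps in toZero, (ε : ℝ) < δ :=
  preimage_mem_comap (Iio_mem_nhds hδ)

/-- The class of a wave net solves the generalized wave equation as soon as `λ = ε` and
`g(u) = f(u)` on the strip for small `ε`. -/
theorem mk_solves {R T : ℝ} (hT : 0 < T) (hTR : T < R) {f g : ℝ → ℝ} (hf : IsOM f)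
    {lam : Eps → ℝ} (u : moderateNets (strip T hT)) (h : IsWaveNet R g lam u.1)
    (hlam : ∀ᶠ ε in toZero, lam ε = ε)
    (hgf : ∀ᶠ ε in toZero, ∀ z ∈ (strip T hT).carrier, g (u.1 ε z) = f (u.1 ε z)) :
    dt (dt (GenFun.mk (strip T hT) u)) - dx (dx (GenFun.mk (strip T hT) u)) =
      ofNumber (strip T hT) epsNumber * superpose f hf (GenFun.mk (strip T hT) u) := by
  let D : ℝ × ℝ → moderateNets (strip T hT) → moderateNets (strip T hT) :=
    fun v u => ⟨derivNet (strip T hT) v u.1, derivNet_mem v u⟩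
  let r : moderateNumbers := ⟨fun ε => (ε : ℝ), 1, 1, Eventually.of_forall fun ε => by
    simp [abs_of_pos ε.2.1]⟩
  let c : moderateNets (strip T hT) := ⟨fun ε _ => r.1 ε, const_mem_moderateNets (strip T hT) r⟩
  let w : moderateNets (strip T hT) := ⟨fun ε z => f (u.1 ε z), hf.comp_mem u⟩
  change GenFun.mk (strip T hT) (D (1, 0) (D (1, 0) u) - D (0, 1) (D (0, 1) u)) =
    GenFun.mk (strip T hT) (c * w)
  refine mk_eq_of_eventually_eqOn ((hlam.and hgf).mono fun ε hε z hz => ?_)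
  have hD : ∀ v, EqOn ((D v (D v u)).1 ε) (dirD v (dirD v (u.1 ε))) (strip T hT).carrier := fun v =>
    derivNet_of_eqOn (fun ε => contDiff_dirD (h.smooth ε) v)
      (derivNet_of_eqOn h.smooth (fun ε z _ => rfl) v) v ε
  have hz' : |z.1| < R := by
    rw [abs_of_nonneg hz.1.1]
    exact hz.1.2.trans_lt hTR
  change (D (1, 0) (D (1, 0) u)).1 ε z - (D (0, 1) (D (0, 1) u)).1 ε z = (ε : ℝ) * f (u.1 ε z)
  rw [hD _ hz, hD _ hz, h.eqn_dt ε hz', hε.1]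
  simp only [hε.2 z hz]
  ring

theorem initialValue_mk {T : ℝ} (hT : 0 < T) (u : moderateNets (strip T hT))
    (w : moderateNets line) (h : ∀ ε x, u.1 ε (0, x) = w.1 ε x) :
    initialValue (GenFun.mk (strip T hT) u) = GenFun.mk line w :=
  mk_eq_of_eventually_eqOn (S := line)
    (u := ⟨fun ε y => u.1 ε (ContinuousLinearMap.inr ℝ ℝ ℝ y), pullback_mem _ (by
      ext x
      simp [strip, line, hT.le]) u⟩) (Eventually.of_forall fun ε x _ => h ε x)

theorem initialValue_dt_mk {T : ℝ} (hT : 0 < T) (u : moderateNets (strip T hT))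
    (hu : ∀ ε, ContDiff ℝ ∞ (u.1 ε)) (w : moderateNets line)
    (h : ∀ ε x, dirD (1, 0) (u.1 ε) (0, x) = w.1 ε x) :
    initialValue (dt (GenFun.mk (strip T hT) u)) = GenFun.mk line w := by
  refine initialValue_mk hT ⟨derivNet (strip T hT) (1, 0) u.1, derivNet_mem _ u⟩ w fun ε x => ?_
  rw [← h]
  exact derivNet_of_eqOn (S := strip T hT) hu (fun ε z _ => rfl) (1, 0) ε
    ⟨left_mem_Icc.2 hT.le, mem_univ x⟩

/-- The complement of the light cone `|x| = |t|`. -/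
def coneCompl : TopologicalSpace.Opens (ℝ × ℝ) :=
  ⟨{z | z.2 + z.1 ≠ 0 ∧ z.2 - z.1 ≠ 0}, (isOpen_ne_fun (by fun_prop) (by fun_prop)).inter
    (isOpen_ne_fun (by fun_prop) (by fun_prop))⟩

theorem singSuppG0_subset_cone {T : ℝ} (hT : 0 < T) {U : GenFun (strip T hT)}
    (h : IsG0 (restrictTo coneCompl U)) :
    singSuppG0 U ⊆ {p : ℝ × ℝ | |p.2| = p.1 ∧ 0 ≤ p.1 ∧ p.1 ≤ T} := by
  rintro ⟨t, x⟩ ⟨hz, hn⟩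
  have ht : 0 ≤ t ∧ t ≤ T := hz.1
  refine ⟨?_, ht⟩
  by_contra hne
  refine hn (mem_iUnion₂.2 ⟨coneCompl, h, ?_, ?_⟩) <;> intro h0 <;> refine hne ?_ <;>
    dsimp only at h0 ⊢
  · rw [show x = -t by linarith, abs_neg, abs_of_nonneg ht.1]
  · rw [show x = t by linarith, abs_of_nonneg ht.1]

/-- The derivatives of a wave net are tame wherever the data are tame at the feet of both backward
characteristics. -/
theorem IsWaveNet.jetTame {R T : ℝ} (hTR : T < R) {g : ℝ → ℝ}
    {lam : Eps → ℝ} {u : Eps → ℝ × ℝ → ℝ} (h : IsWaveNet R g lam u) {m : ℕ} {K : Set (ℝ × ℝ)}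
    {v₀ v₁ : Eps → ℝ → ℝ} (hv₀ : ∀ ε x, u ε (0, x) = v₀ ε x)
    (hv₁ : ∀ ε x, dirD (1, 0) (u ε) (0, x) = v₁ ε x) (hK : ∀ z ∈ K, 0 ≤ z.1 ∧ z.1 ≤ T)
    (hu : TameOn m {z : ℝ × ℝ | 0 ≤ z.1 ∧ z.1 ≤ T} u)
    (h₀ : ∀ σ : ℝ, σ = 1 ∨ σ = -1 → ∀ k,
      TameOn m ((fun z : ℝ × ℝ => z.2 + σ * z.1) '' K) fun ε => iteratedDeriv k (v₀ ε))
    (h₁ : ∀ σ : ℝ, σ = 1 ∨ σ = -1 → ∀ k,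
      TameOn m ((fun z : ℝ × ℝ => z.2 + σ * z.1) '' K) fun ε => iteratedDeriv k (v₁ ε)) (n : ℕ) :
    JetTame m (1, 0) (0, 1) K n u := by
  have hchar : ∀ σ : ℝ, σ = 1 ∨ σ = -1 → ∀ n, JetTame m (σ, 1) (σ, 1) K n u := fun σ hσ n => by
    have hinit := h.jetTame_initial (m := m) (P := (fun z : ℝ × ℝ => z.2 + σ * z.1) '' K)
      (by simpa only [hv₀] using h₀ σ hσ) (by simpa only [hv₁] using h₁ σ hσ)
    have hsub : IsWaveNet.charSet T σ ((fun z : ℝ × ℝ => z.2 + σ * z.1) '' K) ⊆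
        {z : ℝ × ℝ | 0 ≤ z.1 ∧ z.1 ≤ T} := fun z hz => ⟨hz.1, hz.2.1⟩
    have hK' : K ⊆ IsWaveNet.charSet T σ ((fun z : ℝ × ℝ => z.2 + σ * z.1) '' K) := fun z hz =>
      ⟨(hK z hz).1, (hK z hz).2, mem_image_of_mem _ hz⟩
    exact (h.jetTame_char hσ hTR (hu.mono hsub) hinit n).mono hK'
  refine JetTame.of_char h.smooth (h.jetTame_of_char (fun z hz => ?_) (hchar 1 (Or.inl rfl))
    (hchar (-1) (Or.inr rfl)) n)
  rw [abs_of_nonneg (hK z hz).1]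
  exact (hK z hz).2.trans_lt hTR

/-- A net of wave equations with a common truncated nonlinearity, whose coefficient is `ε` for small
`ε` and `0` otherwise. The coefficient is so small that the solutions exist on the whole strip and
differ by at most `1` from the solutions of the linear equation. -/
theorem exists_waveNet {f : ℝ → ℝ} (hf : ContDiff ℝ ∞ f) {T M : ℝ} (hT : 0 < T)
    {v₀ v₁ : Eps → ℝ → ℝ} (h₀ : ∀ ε, ContDiff ℝ ∞ (v₀ ε)) (h₁ : ∀ ε, ContDiff ℝ ∞ (v₁ ε)) :
    ∃ (g : ℝ → ℝ) (lam : Eps → ℝ) (u : Eps → ℝ × ℝ → ℝ), IsWaveNet (T + 1) g lam u ∧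
      (∀ y, |y| ≤ M → g y = f y) ∧ (∀ᶠ ε in toZero, lam ε = ε) ∧
      (∀ ε x, u ε (0, x) = v₀ ε x) ∧ (∀ ε x, dirD (1, 0) (u ε) (0, x) = v₁ ε x) ∧
      ∀ ε, ∀ z : ℝ × ℝ, 0 ≤ z.1 → z.1 ≤ T → |u ε z - dAlembert (v₀ ε) (v₁ ε) z| ≤ 1 := by
  obtain ⟨g, hg, hgb, hgf⟩ := exists_truncation hf M
  obtain ⟨G, hG⟩ := hgb 0
  obtain ⟨L, hL⟩ := hgb 1
  simp only [iteratedDeriv_zero, iteratedDeriv_one] at hG hL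
  have hG0 : 0 ≤ G := (abs_nonneg _).trans (hG 0)
  have hL0 : 0 ≤ L := (abs_nonneg _).trans (hL 0)
  obtain ⟨δ, hδ, hδL, hδG⟩ : ∃ δ : ℝ, 0 < δ ∧ δ * L * (2 * (T + 1) + 1) ^ 2 ≤ 2 ∧
      δ * G * T ^ 2 ≤ 1 := by
    refine ⟨1 / (1 + L * (2 * (T + 1) + 1) ^ 2 + G * T ^ 2), by positivity, ?_, ?_⟩ <;>
      rw [mul_assoc, div_mul_eq_mul_div, div_le_iff₀ (by positivity)] <;>
      nlinarith [mul_nonneg hL0 (sq_nonneg (2 * (T + 1) + 1)), mul_nonneg hG0 (sq_nonneg T)]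
  let lam : Eps → ℝ := fun ε => if (ε : ℝ) < δ then ε else 0
  have hlam : ∀ ε, 0 ≤ lam ε ∧ lam ε ≤ δ ∧ lam ε ≤ 1 := fun ε => by
    dsimp only [lam]
    split_ifs with h
    · exact ⟨ε.2.1.le, h.le, ε.2.2⟩
    · exact ⟨le_rfl, hδ.le, zero_le_one⟩
  have hex := fun ε => exists_wave_solution hg (h₀ ε) (h₁ ε) hG (abs_sub_le_of_bounded_deriv hg hL)
    (T := T + 1) (by linarith) (hlam ε).1 (le_trans (by gcongr; exact (hlam ε).2.1) hδL)
  choose u hu hud hu₀ hu₁ hueq using hex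
  refine ⟨g, lam, u, ⟨by linarith, hu, hg, hgb, fun ε => ?_, hueq⟩, hgf, ?_, hu₀, hu₁,
    fun ε z hz0 hzT => ?_⟩
  · rw [abs_of_nonneg (hlam ε).1]
    exact (hlam ε).2.2
  · exact (eventually_toZero_lt hδ).mono fun ε hε => if_pos hε
  · refine (hud ε z).trans (le_trans ?_ hδG)
    gcongr
    exact (hlam ε).2.1

end Colombeau

theorem theorem3p1 (f : ℝ → ℝ) (hf : IsOM f) (hf0 : f 0 = 0)
    (U₀ U₁ : GenFun line)
    (hU₀reg : IsG0 (restrictTo puncturedLine U₀)) (hU₁reg : IsG0 (restrictTo puncturedLine U₁))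
    (hU₀supp : IsCompact (supp U₀)) (hU₁supp : IsCompact (supp U₁))
    (hU₀bdd : BoundedTypeOn (ddx U₀) Set.univ) (hU₁bdd : BoundedTypeOn U₁ Set.univ)
    (T : ℝ) (hT : 0 < T) :
    ∃ U : GenFun (strip T hT),
      dt (dt U) - dx (dx U) = ofNumber (strip T hT) epsNumber * superpose f hf U ∧
      initialValue U = U₀ ∧
      initialValue (dt U) = U₁ ∧
      singSuppG0 U ⊆ {p : ℝ × ℝ | |p.2| = p.1 ∧ 0 ≤ p.1 ∧ p.1 ≤ T} := by
  obtain ⟨v₀, R₀, hR₀, rfl, hv₀⟩ := exists_rep_eq_zero U₀ hU₀supp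
  obtain ⟨v₁, R₁, -, rfl, hv₁⟩ := exists_rep_eq_zero U₁ hU₁supp
  obtain ⟨C₀, hC₀⟩ := exists_bound_of_ddx v₀ hR₀ hv₀ hU₀bdd
  obtain ⟨C₁, hC₁⟩ := exists_bound_of_eq_zero v₁ hv₁ hU₁bdd
  obtain ⟨g, lam, u, hnet, hgf, hlam, hu₀, hu₁, hu⟩ := exists_waveNet (M := C₀ + C₁ * T + 1) hf.1 hT
    (contDiff_rep v₀) (contDiff_rep v₁)
  have hTR : T < T + 1 := by linarith
  have hbd : ∀ᶠ ε in toZero, ∀ z ∈ {z : ℝ × ℝ | 0 ≤ z.1 ∧ z.1 ≤ T},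
      |u ε z| ≤ C₀ + C₁ * T + 1 := by
    refine (hC₀.and hC₁).mono fun ε hε z hz => ?_
    have h1 := hu ε z hz.1 hz.2
    have h2 := abs_dAlembert_le hε.1 hε.2 hz.1 hz.2
    have h3 := abs_sub_abs_le_abs_sub (u ε z) (dAlembert (v₀.1 ε) (v₁.1 ε) z)
    linarith
  have himg : ∀ (σ : ℝ) {K : Set (ℝ × ℝ)}, IsCompact K →
      IsCompact ((fun z : ℝ × ℝ => z.2 + σ * z.1) '' K) := fun σ K hK => hK.image (by fun_prop)
  have hmod : u ∈ moderateNets (strip T hT) := by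
    refine ⟨fun ε => (hnet.smooth ε).contDiffOn, fun K hKS hK k => ?_⟩
    have hjet := hnet.jetTame (m := 1) (K := K) hTR hu₀ hu₁ (fun z hz => (hKS hz).1)
      (tameOn_of_bounded hbd) (fun σ _ k => tameOn_one_iteratedDeriv v₀ (himg σ hK) k)
      (fun σ _ k => tameOn_one_iteratedDeriv v₁ (himg σ hK) k) k
    refine tameOn_one_iff.1 ((hjet.tameOn_iteratedFDeriv hnet.smooth).congr fun ε z hz => ?_)
    exact derivSize_of_smooth (hnet.smooth ε) k (hKS hz)
  refine ⟨GenFun.mk _ ⟨u, hmod⟩, ?_, ?_, ?_, ?_⟩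
  · exact mk_solves hT hTR hf ⟨u, hmod⟩ hnet hlam (hbd.mono fun ε hε z hz => hgf _ (hε z hz.1))
  · exact initialValue_mk hT _ _ hu₀
  · exact initialValue_dt_mk hT _ hnet.smooth _ hu₁
  · refine singSuppG0_subset_cone hT fun vs K hKS hK => ?_
    have hfoot : ∀ σ : ℝ, σ = 1 ∨ σ = -1 →
        (0 : ℝ) ∉ (fun z : ℝ × ℝ => z.2 + σ * z.1) '' K := by
      rintro σ hσ ⟨z, hz, h0⟩
      have hz' : z.2 + z.1 ≠ 0 ∧ z.2 - z.1 ≠ 0 := (hKS hz).2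
      rcases hσ with rfl | rfl
      · exact hz'.1 (by linarith)
      · exact hz'.2 (by linarith)
    have hjet := hnet.jetTame (m := 0) (K := K) hTR hu₀ hu₁ (fun z hz => (hKS hz).1.1)
      (tameOn_of_bounded hbd)
      (fun σ hσ k => tameOn_zero_iteratedDeriv v₀ hU₀reg (himg σ hK) (hfoot σ hσ) k)
      (fun σ hσ k => tameOn_zero_iteratedDeriv v₁ hU₁reg (himg σ hK) (hfoot σ hσ) k)
    obtain ⟨w, hw, hwe⟩ := exists_foldr_partialD_eq (S := (strip T hT).interOpen coneCompl)
      ⟨u, restrict_mem coneCompl ⟨u, hmod⟩⟩ hnet.smooth vs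
    refine ⟨w, hw.symm, tameOn_zero_iff.1 ?_⟩
    exact (JetTame.tameOn_foldr hnet.smooth hjet vs).congr fun ε z hz => hwe ε (hKS hz)
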